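/- **Conventions.** Manifolds, functions, forms and actions are $C^\infty$ and finite-dimensional. A property holds for *general* points of a space if it holds on an open dense subset. On a symplectic manifold $(M,\omega)$ let $\omega(\operatorname{sgrad} f,\cdot)=df$ and $\{f,g\}=\omega(\operatorname{sgrad} f,\operatorname{sgrad} g)$. For a linear space $\mathcal F\subset C^\infty(M)$ put $F_x=\operatorname{span}\{df(x): f\in\mathcal F\}\subset T_x^*M$ and let $K_x\subset F_x$ be the kernel of the restriction to $F_x$ of the Poisson structure on $T^*_xM$. $\mathcal F$ is a *complete algebra* if it is closed under $\{\cdot,\cdot\}$ and there are constants $\operatorname{ddim}\mathcal F$, $\operatorname{dind}\mathcal F$ with $\dim F_x=\operatorname{ddim}\mathcal F$ and $\dim K_x=\operatorname{dind}\mathcal F$ for general $x\in M$ and $\operatorname{ddim}\mathcal F+\operatorname{dind}\mathcal F=\dim M$. The Hamiltonian system $\dot x=\operatorname{sgrad}H(x)$ is *completely integrable* if there is a complete algebra $\mathcal F$ of integrals, i.e. with $\{H,f\}=0$ for all $f\in\mathcal F$. **Setting.** Let $(M,\omega)$ be a connected symplectic manifold of dimension $2n$ with a Hamiltonian action of a connected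 Lie group $G$ with Lie algebra $\mathfrak g$ and moment map $\Phi:M\to\mathfrak g^*$: $G$ acts by symplectomorphisms, for each $\xi\in\mathfrak g$ the one-parameter group $\exp(t\xi)$ is generated by $\operatorname{sgrad} f_\xi$, where $f_\xi(x)=\Phi(x)(\xi)$, and $f_{[\xi,\eta]}=\{f_\xi,f_\eta\}$. Let $\mathcal F_2\subset C^\infty(M)$ be the algebra of $G$-invariant functions. Assume that there is $m$ such that for general $x\in M$ $$\dim G\cdot x=m\quad\text{and}\quad \operatorname{span}\{df(x): f\in\mathcal F_2\}=\operatorname{ann}(T_x(G\cdot x)).$$ On $\mathfrak g^*$ let $\{f,g\}_{\mathfrak g^*}(\mu)=\mu([df(\mu),dg(\mu)])$ be the Lie–Poisson bracket, and let $\mathcal O(\mu)$ be the coadjoint orbit of $\mu$, with its topology as the homogeneous space $G/G_\mu$. **Theorem.** Let $h,f_1,\dots,f_l\in C^\infty(\mathfrak g^*)$ be such that the Euler equations $\dot\mu=\mathrm{ad}^*_{dh(\mu)}\mu$ are completely integrable on general coadjoint orbits in $\Phi(M)$ by means of the Lie–Poisson commuting integrals $f_1,\dots,f_l$; that is, for general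 $x\in M$ the orbit $\mathcal O=\mathcal O(\Phi(x))$ has dimension $2l$, on $\mathcal O$ one has $\{h,f_i\}_{\mathfrak g^*}=0$ and $\{f_i,f_j\}_{\mathfrak g^*}=0$ for all $i,j$, and the differentials of $f_1|_{\mathcal O},\dots,f_l|_{\mathcal O}$ are linearly independent at general points of $\mathcal O$. Then the Hamiltonian system on $M$ with Hamiltonian $H=h\circ\Phi$ is completely integrable, and $$\operatorname{span}\{f_1\circ\Phi,\dots,f_l\circ\Phi\}+\mathcal F_2$$ is a complete algebra of its integrals. So is the subalgebra of $C^\infty(M)$ generated under multiplication by $f_1\circ\Phi,\dots,f_l\circ\Phi$ and $\mathcal F_2$. -/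

import Mathlib

open scoped Manifold ContDiff

noncomputable section

/-- A property holds for general points of a topological space if it holds at all points of
some open dense subset. -/
def ForGeneral {X : Type*} [TopologicalSpace X] (P : X → Prop) : Prop :=
  ∃ U : Set X, IsOpen U ∧ Dense U ∧ ∀ x ∈ U, P x

section Symplectic

variable {d : ℕ} {M : Type*} [TopologicalSpace M] [ChartedSpace (EuclideanSpace ℝ (Fin d)) M]

/-- The representation in the chart around `x₀` of a field of alternating 2-forms on `M`: its
pullback under the inverse of the chart. -/
def localForm (Ω : ∀ x : M, TangentSpace (𝓡 d) x [⋀^Fin 2]→L[ℝ] ℝ) (x₀ : M)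
    (y : EuclideanSpace ℝ (Fin d)) : EuclideanSpace ℝ (Fin d) [⋀^Fin 2]→L[ℝ] ℝ :=
  (Ω ((extChartAt (𝓡 d) x₀).symm y)).compContinuousLinearMap
    (mfderiv 𝓘(ℝ, EuclideanSpace ℝ (Fin d)) (𝓡 d) (extChartAt (𝓡 d) x₀).symm y)

variable (d M) in
/-- A symplectic form on a `d`-dimensional manifold: a smooth, closed, nondegenerate
differential 2-form. Smoothness and closedness are expressed in the charts of the atlas. -/
structure SymplecticForm where
  /-- the value of the form at a point -/
  form : ∀ x : M, TangentSpace (𝓡 d) x [⋀^Fin 2]→L[ℝ] ℝ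
  smooth : ∀ x₀ : M, ContDiffOn ℝ ∞ (localForm form x₀) (extChartAt (𝓡 d) x₀).target
  closed : ∀ x₀ : M, ∀ y ∈ (extChartAt (𝓡 d) x₀).target, extDeriv (localForm form x₀) y = 0
  nondegenerate : ∀ (x : M) (v : TangentSpace (𝓡 d) x),
    (∀ w : TangentSpace (𝓡 d) x, form x ![v, w] = 0) → v = 0

instance tangentSpaceFiniteDimensional (x : M) : FiniteDimensional ℝ (TangentSpace (𝓡 d) x) :=
  inferInstanceAs (FiniteDimensional ℝ (EuclideanSpace ℝ (Fin d)))

instance tangentSpaceT2 (x : M) : T2Space (TangentSpace (𝓡 d) x) :=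
  inferInstanceAs (T2Space (EuclideanSpace ℝ (Fin d)))

namespace SymplecticForm

variable (Ω : SymplecticForm d M)

theorem form_add_left (x : M) (v v' w : TangentSpace (𝓡 d) x) :
    Ω.form x ![v + v', w] = Ω.form x ![v, w] + Ω.form x ![v', w] :=
  (Ω.form x).toMultilinearMap.cons_add ![w] v v'

theorem form_smul_left (x : M) (c : ℝ) (v w : TangentSpace (𝓡 d) x) :
    Ω.form x ![c • v, w] = c * Ω.form x ![v, w] :=
  (Ω.form x).toMultilinearMap.cons_smul ![w] c v

theorem form_swap (x : M) (v w : TangentSpace (𝓡 d) x) :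
    Ω.form x ![v, w] = -Ω.form x ![w, v] := by
  have h := (Ω.form x).toAlternatingMap.map_swap ![w, v] (i := 0) (j := 1) (by decide)
  rw [← show Ω.form x (![w, v] ∘ Equiv.swap 0 1) = -Ω.form x ![w, v] from h]
  congr 1
  ext i
  fin_cases i <;> rfl

theorem form_add_right (x : M) (v w w' : TangentSpace (𝓡 d) x) :
    Ω.form x ![v, w + w'] = Ω.form x ![v, w] + Ω.form x ![v, w'] := by
  rw [Ω.form_swap x v, Ω.form_swap x v w, Ω.form_swap x v w', form_add_left, neg_add]

theorem form_smul_right (x : M) (c : ℝ) (v w : TangentSpace (𝓡 d) x) :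
    Ω.form x ![v, c • w] = c * Ω.form x ![v, w] := by
  rw [Ω.form_swap x v, Ω.form_swap x v w, form_smul_left, mul_neg]

/-- The map `v ↦ Ω(v, ·)` from tangent vectors to covectors at `x`. -/
def flat (x : M) : TangentSpace (𝓡 d) x →ₗ[ℝ] (TangentSpace (𝓡 d) x →L[ℝ] ℝ) where
  toFun v := LinearMap.toContinuousLinearMap
    { toFun := fun w => Ω.form x ![v, w]
      map_add' := Ω.form_add_right x v
      map_smul' := fun c w => Ω.form_smul_right x c v w }
  map_add' v v' := by
    ext w
    exact Ω.form_add_left x v v' w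
  map_smul' c v := by
    ext w
    exact Ω.form_smul_left x c v w

theorem flat_apply (x : M) (v w : TangentSpace (𝓡 d) x) :
    Ω.flat x v w = Ω.form x ![v, w] := rfl

theorem flat_injective (x : M) : Function.Injective (Ω.flat x) := by
  rw [← LinearMap.ker_eq_bot, LinearMap.ker_eq_bot']
  intro v hv
  refine Ω.nondegenerate x v fun w => ?_
  rw [← flat_apply, hv]
  rfl

theorem flat_bijective (x : M) : Function.Bijective (Ω.flat x) := by
  refine ⟨Ω.flat_injective x, ?_⟩
  refine (LinearMap.injective_iff_surjective_of_finrank_eq_finrank ?_).1 (Ω.flat_injective x)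
  rw [← (LinearMap.toContinuousLinearMap
    (𝕜 := ℝ) (E := TangentSpace (𝓡 d) x) (F' := ℝ)).finrank_eq]
  exact Subspace.dual_finrank_eq.symm

/-- The inverse of `flat`: the vector `v` with `Ω(v, ·) = α`. -/
def sharp (x : M) : (TangentSpace (𝓡 d) x →L[ℝ] ℝ) ≃ₗ[ℝ] TangentSpace (𝓡 d) x :=
  (LinearEquiv.ofBijective (Ω.flat x) (Ω.flat_bijective x)).symm

theorem form_sharp (x : M) (α : TangentSpace (𝓡 d) x →L[ℝ] ℝ) (w : TangentSpace (𝓡 d) x) :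
    Ω.form x ![Ω.sharp x α, w] = α w := by
  rw [← flat_apply]
  exact congrArg (fun β => β w)
    ((LinearEquiv.ofBijective (Ω.flat x) (Ω.flat_bijective x)).apply_symm_apply α)

/-- The Poisson structure on covectors at `x`. -/
def cobracket (x : M) (α β : TangentSpace (𝓡 d) x →L[ℝ] ℝ) : ℝ :=
  Ω.form x ![Ω.sharp x α, Ω.sharp x β]

theorem cobracket_eq (x : M) (α β : TangentSpace (𝓡 d) x →L[ℝ] ℝ) :
    Ω.cobracket x α β = α (Ω.sharp x β) :=
  Ω.form_sharp x α _

end SymplecticForm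

/-- The differential `df(x)` of a real function, as a covector. -/
def differential (f : M → ℝ) (x : M) : TangentSpace (𝓡 d) x →L[ℝ] ℝ :=
  mfderiv (𝓡 d) 𝓘(ℝ, ℝ) f x

namespace SymplecticForm

variable (Ω : SymplecticForm d M)

/-- The Hamiltonian vector field `sgrad f`, with `Ω(sgrad f, ·) = df`. -/
def sgrad (f : M → ℝ) (x : M) : TangentSpace (𝓡 d) x :=
  Ω.sharp x (differential f x)

/-- The Poisson bracket `{f, g} = Ω(sgrad f, sgrad g)`. -/
def poisson (f g : M → ℝ) (x : M) : ℝ :=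
  Ω.form x ![Ω.sgrad f x, Ω.sgrad g x]

end SymplecticForm

/-- `F_x = span {df(x) : f ∈ F}`. -/
def differentialSpan (F : Submodule ℝ C^∞⟮𝓡 d, M; ℝ⟯) (x : M) :
    Submodule ℝ (TangentSpace (𝓡 d) x →L[ℝ] ℝ) :=
  Submodule.span ℝ {α | ∃ f ∈ F, α = differential f x}

/-- The kernel of the restriction of the Poisson structure at `x` to a space `V` of covectors. -/
def cobracketKernel (Ω : SymplecticForm d M) (x : M)
    (V : Submodule ℝ (TangentSpace (𝓡 d) x →L[ℝ] ℝ)) :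
    Submodule ℝ (TangentSpace (𝓡 d) x →L[ℝ] ℝ) where
  carrier := {α | α ∈ V ∧ ∀ β ∈ V, Ω.cobracket x α β = 0}
  zero_mem' := ⟨V.zero_mem, fun β _ => by rw [Ω.cobracket_eq]; rfl⟩
  add_mem' := fun {a b} ha hb => ⟨V.add_mem ha.1 hb.1, fun β hβ => by
    have h1 := ha.2 β hβ
    have h2 := hb.2 β hβ
    rw [Ω.cobracket_eq] at h1 h2 ⊢
    rw [add_apply, h1, h2, add_zero]⟩
  smul_mem' := fun c a ha => ⟨V.smul_mem c ha.1, fun β hβ => by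
    have h1 := ha.2 β hβ
    rw [Ω.cobracket_eq] at h1 ⊢
    rw [smul_apply, h1, smul_zero]⟩

/-- `F` is a complete algebra of functions: a space of smooth functions closed under the Poisson
bracket with `ddim F + dind F = dim M`, where `ddim F` and `dind F` are the dimensions of `F_x`
and of the kernel of the Poisson structure restricted to `F_x`, for general `x`. -/
structure IsCompleteAlgebra (Ω : SymplecticForm d M) (F : Submodule ℝ C^∞⟮𝓡 d, M; ℝ⟯) : Prop where
  closed : ∀ f ∈ F, ∀ g ∈ F, ∃ k ∈ F, ∀ x, k x = Ω.poisson f g x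
  complete : ∃ ddim dind : ℕ, ddim + dind = d ∧
    ForGeneral fun x : M =>
      Module.finrank ℝ (differentialSpan F x) = ddim ∧
      Module.finrank ℝ (cobracketKernel Ω x (differentialSpan F x)) = dind

/-- All members of `F` are integrals of the Hamiltonian system of `H`. -/
def AreIntegrals (Ω : SymplecticForm d M) (H : M → ℝ) (F : Submodule ℝ C^∞⟮𝓡 d, M; ℝ⟯) : Prop :=
  ∀ f ∈ F, ∀ x, Ω.poisson H f x = 0

/-- The Hamiltonian system of `H` is completely integrable: it possesses a complete algebra
of integrals. -/
def IsCompletelyIntegrable (Ω : SymplecticForm d M) (H : M → ℝ) : Prop :=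
  ∃ F : Submodule ℝ C^∞⟮𝓡 d, M; ℝ⟯, IsCompleteAlgebra Ω F ∧ AreIntegrals Ω H F

end Symplectic

section LieAlgebra

/-- The Lie algebra `𝔤 = T₁G` of a `k`-dimensional Lie group as a normed vector space: it is the
model space (`TangentSpace (𝓡 k) (1 : G)` unfolds to it). -/
abbrev LieAlg (k : ℕ) : Type := EuclideanSpace ℝ (Fin k)

/-- The dual `𝔤*` of the Lie algebra. -/
abbrev LieCoalg (k : ℕ) : Type := StrongDual ℝ (LieAlg k)

variable {k : ℕ} (G : Type*) [TopologicalSpace G] [ChartedSpace (EuclideanSpace ℝ (Fin k)) G]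
  [Group G]

/-- The Lie bracket of `𝔤`, i.e. Mathlib's bracket on `GroupLieAlgebra`. -/
def lieBr (ξ η : LieAlg k) : LieAlg k :=
  (⁅(show GroupLieAlgebra (𝓡 k) G from ξ), (show GroupLieAlgebra (𝓡 k) G from η)⁆ :
    GroupLieAlgebra (𝓡 k) G)

/-- The operator `ad_ξ = [ξ, ·]` of `𝔤`. -/
def adOp [LieGroup (𝓡 k) ∞ G] (ξ : LieAlg k) : LieAlg k →L[ℝ] LieAlg k :=
  haveI : LieGroup (𝓡 k) (minSmoothness ℝ 3) G :=
    LieGroup.of_le (n := ∞) (by rw [minSmoothness_of_isRCLikeNormedField]; exact (ENat.LEInfty.out : (3 : WithTop ℕ∞) ≤ ∞))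
  LinearMap.toContinuousLinearMap
    { toFun := fun η => lieBr G ξ η
      map_add' := fun η η' =>
        lie_add (show GroupLieAlgebra (𝓡 k) G from ξ) (show GroupLieAlgebra (𝓡 k) G from η)
          (show GroupLieAlgebra (𝓡 k) G from η')
      map_smul' := fun c η =>
        lie_smul c (show GroupLieAlgebra (𝓡 k) G from ξ) (show GroupLieAlgebra (𝓡 k) G from η) }

theorem adOp_apply [LieGroup (𝓡 k) ∞ G] (ξ η : LieAlg k) : adOp G ξ η = lieBr G ξ η := rfl

variable {G} in
/-- The adjoint action `Ad_g`: the derivative at `1` of the conjugation `y ↦ g y g⁻¹`. -/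
def adjointAction (g : G) : LieAlg k →L[ℝ] LieAlg k :=
  mfderiv (𝓡 k) (𝓡 k) (fun y : G => g * y * g⁻¹) 1

variable {G} in
/-- The coadjoint action `(Ad*_g μ)(η) = μ(Ad_{g⁻¹} η)`. -/
def coadjointAction (g : G) (μ : LieCoalg k) : LieCoalg k :=
  μ.comp (adjointAction g⁻¹)

/-- The tangent space `{ad*_ξ ν : ξ ∈ 𝔤}` of the coadjoint orbit through `ν`, where
`(ad*_ξ ν)(η) = ν([ξ, η])` (the sign convention for `ad*` does not affect this space).
The set is itself a linear subspace of `𝔤*`. -/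
def coadjointOrbitTangent [LieGroup (𝓡 k) ∞ G] (ν : LieCoalg k) : Submodule ℝ (LieCoalg k) :=
  Submodule.span ℝ (Set.range fun ξ : LieAlg k => ν.comp (adOp G ξ))

/-- The differential `df(ν) ∈ 𝔤** = 𝔤` of a function on `𝔤*`, as an element of `𝔤`. -/
def coalgDifferential (f : LieCoalg k → ℝ) (ν : LieCoalg k) : LieAlg k :=
  ∑ i, fderiv ℝ f ν (EuclideanSpace.proj i) • EuclideanSpace.single i (1 : ℝ)

/-- This is the element of `𝔤` that represents the derivative of `f`. -/
theorem apply_coalgDifferential (f : LieCoalg k → ℝ) (ν α : LieCoalg k) :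
    α (coalgDifferential f ν) = fderiv ℝ f ν α := by
  have hα : α = ∑ i, α (EuclideanSpace.single i (1 : ℝ)) •
      (EuclideanSpace.proj i : LieCoalg k) := by
    ext v
    conv_lhs => rw [← (EuclideanSpace.basisFun (Fin k) ℝ).sum_repr v]
    simp [mul_comm]
  conv_rhs => rw [hα]
  simp [coalgDifferential, mul_comm]

/-- The Lie–Poisson bracket on `𝔤*`. -/
def liePoisson (f g : LieCoalg k → ℝ) (ν : LieCoalg k) : ℝ :=
  ν (lieBr G (coalgDifferential f ν) (coalgDifferential g ν))

/-- The Euler equations `μ' = ad*_{dh(μ)} μ`, restricted to the coadjoint orbit `O` of `μ`, are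
completely integrable by means of the commuting integrals `f 0, …, f (l - 1)`: `dim O = 2l`, on
`O` the `f i` commute with `h` and with each other, and the differentials of the restrictions
`f i|_O` are independent at general points of `O`.
(The orbit carries the topology of `G ⧸ G_μ`, for which the open dense subsets of `O` are those
whose preimage under the open map `g ↦ Ad*_g μ` is open and dense in `G`.) -/
structure IsIntegrableOnCoadjointOrbit [LieGroup (𝓡 k) ∞ G] (h : LieCoalg k → ℝ) {l : ℕ}
    (f : Fin l → LieCoalg k → ℝ) (μ : LieCoalg k) : Prop where
  dim_orbit : Module.finrank ℝ (coadjointOrbitTangent G μ) = 2 * l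
  integral : ∀ (g : G) (i : Fin l), liePoisson G h (f i) (coadjointAction g μ) = 0
  commute : ∀ (g : G) (i j : Fin l), liePoisson G (f i) (f j) (coadjointAction g μ) = 0
  independent : ForGeneral fun g : G =>
    LinearIndependent ℝ fun i : Fin l =>
      (fderiv ℝ (f i) (coadjointAction g μ)).toLinearMap.domRestrict
        (coadjointOrbitTangent G (coadjointAction g μ))

end LieAlgebra

section Action

variable {k d : ℕ} (G : Type*) [TopologicalSpace G] [ChartedSpace (EuclideanSpace ℝ (Fin k)) G]
  [Group G] {M : Type*} [TopologicalSpace M] [ChartedSpace (EuclideanSpace ℝ (Fin d)) M]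
  [MulAction G M]

/-- The derivative at `1` of the orbit map `g ↦ g • x`; it sends `ξ ∈ 𝔤` to the value at `x` of
the generator of the one-parameter group of transformations `exp(tξ)`. -/
def infinitesimalAction (x : M) : LieAlg k →L[ℝ] TangentSpace (𝓡 d) x :=
  mfderiv (𝓡 k) (𝓡 d) (fun g : G => g • x) 1

variable (k d) in
/-- The tangent space `T_x(G·x)` to the orbit. -/
def orbitTangent (x : M) : Submodule ℝ (TangentSpace (𝓡 d) x) :=
  LinearMap.range (infinitesimalAction G x : LieAlg k →L[ℝ] TangentSpace (𝓡 d) x).toLinearMap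

/-- A smooth action is Hamiltonian with moment map `Φ`: `G` acts by symplectomorphisms, the
one-parameter groups `exp(tξ)` are generated by the Hamiltonian vector fields of the functions
`f_ξ(x) = Φ(x)(ξ)`, and `f_[ξ,η] = {f_ξ, f_η}`. -/
structure IsHamiltonianAction (Ω : SymplecticForm d M)
    (Φ : C^∞⟮𝓡 d, M; 𝓘(ℝ, LieCoalg k), LieCoalg k⟯) : Prop where
  smooth : ContMDiffSMul (𝓡 k) (𝓡 d) ∞ G M
  symplectic : ∀ (g : G) (x : M) (v w : TangentSpace (𝓡 d) x),
    Ω.form (g • x) ![mfderiv (𝓡 d) (𝓡 d) (fun y : M => g • y) x v,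
      mfderiv (𝓡 d) (𝓡 d) (fun y : M => g • y) x w] = Ω.form x ![v, w]
  generator : ∀ (ξ : LieAlg k) (x : M),
    infinitesimalAction G x ξ = Ω.sgrad (fun y => Φ y ξ) x
  bracket : ∀ (ξ η : LieAlg k) (x : M),
    Φ x (lieBr G ξ η) = Ω.poisson (fun y => Φ y ξ) (fun y => Φ y η) x

variable (d M) in
/-- The algebra `F₂` of `G`-invariant smooth functions on `M`. -/
def invariantFunctions : Submodule ℝ C^∞⟮𝓡 d, M; ℝ⟯ where
  carrier := {f | ∀ (g : G) (x : M), f (g • x) = f x}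
  zero_mem' := fun _ _ => rfl
  add_mem' := fun {a b} ha hb g x => by
    show a (g • x) + b (g • x) = a x + b x
    rw [ha, hb]
  smul_mem' := fun c a ha g x => by
    show c • a (g • x) = c • a x
    rw [ha]

variable (k d M) in
/-- For general `x`, the orbit `G·x` has a fixed dimension `m`, and the differentials at `x` of
the invariant functions span the annihilator of `T_x(G·x)`. -/
def InvariantsSpanAnnihilators : Prop :=
  ∃ m : ℕ, ForGeneral fun x : M =>
    Module.finrank ℝ (orbitTangent k d G x) = m ∧
    (differentialSpan (invariantFunctions d G M) x :
        Set (TangentSpace (𝓡 d) x →L[ℝ] ℝ)) =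
      {α | ∀ v ∈ orbitTangent k d G x, α v = 0}

end Action

end

/-!
Write `T = T_x(G·x)`, and `⊥` for orthogonals with respect to the symplectic form. At a general
point `x`, the symplectic form turns the differentials of the invariant functions into `T^⊥`, and
the differential of `f_i ∘ Φ` into the value at `x` of the generator of `df_i(Φ(x)) ∈ 𝔤`, a vector
of `T` (`IsHamiltonianAction.sgrad_comp_moment`). The form on `T` is the pullback of the form
`Φ(x)([·, ·])` of the coadjoint orbit, so it has rank `2l`; the `l` generators commute and are
independent modulo `T^⊥`, so they span a Lagrangian subspace of `T / (T ∩ T^⊥)`. Hence the space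
`F_x` is coisotropic, which is what `ddim + dind = dim M` says. This is the linear algebra of
`finrank_span_sup_orthogonal`, applied in `IsHamiltonianAction.finrank_differentialSpan`.

For this, the `df_i(Φ(x))` must be independent on the tangent space of the coadjoint orbit for
general `x ∈ M`, while the hypothesis speaks of general points of the orbit of `Φ(x)`. The
two are linked by the equivariance `Φ(g x) = Ad*_g Φ(x)` (`IsHamiltonianAction.map_smul`), which is
integrated from `f_[ξ, η] = {f_ξ, f_η}`. The required derivative `d(Ad)(1) = ad`
(`hasMFDerivAt_adjointAction`) is computed in a chart, by differentiating
`ab = (a b a⁻¹) a` twice.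

The brackets of the generators are given by the moment map being Poisson, by the invariant
functions being constant along `T`, and by the invariance of the form; that the bracket of smooth
functions is smooth (`SymplecticForm.contMDiff_poisson`) is again checked in charts. The Leibniz
rule carries everything over from the linear span to the generated algebra.
-/

noncomputable section

/-! ### The derivative of the conjugation in a local group -/

section LocalGroup

open Filter Topology

/-- Local form of `d(Ad)(1) = ad`. Let `m` be a local multiplication around the unit `c` and `C` the
conjugation `(a, b) ↦ a b a⁻¹`, so that `ab = (a b a⁻¹) a`. Then the derivative in `a` at `c` of
`Ad_a w = ∂_b C(a, b) w` is the Lie bracket of the left-invariant vector fields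
`a ↦ ∂_b m(a, b) v` and `a ↦ ∂_b m(a, b) w`. This comes from differentiating the relation
`m(a, b) = m(C(a, b), a)` in `b` and then in `a`. -/
theorem fderiv_conj_eq_lieBracket {E : Type*} [NormedAddCommGroup E] [NormedSpace ℝ E]
    {m C : E × E → E} {c : E} (hm : ContDiffAt ℝ 2 m (c, c)) (hC : ContDiffAt ℝ 2 C (c, c))
    (hm₁ : ∀ᶠ a in 𝓝 c, m (a, c) = a) (hm₂ : ∀ᶠ b in 𝓝 c, m (c, b) = b)
    (hC₁ : ∀ᶠ a in 𝓝 c, C (a, c) = c)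
    (hmC : ∀ᶠ p in 𝓝 (c, c), m p = m (C p, p.1)) (v w : E) :
    DifferentiableAt ℝ (fun a => fderiv ℝ (fun b => C (a, b)) c w) c ∧
    fderiv ℝ (fun a => fderiv ℝ (fun b => C (a, b)) c w) c v =
      VectorField.lieBracket ℝ (fun a => fderiv ℝ (fun b => m (a, b)) c v)
        (fun a => fderiv ℝ (fun b => m (a, b)) c w) c := by
  have hl : ContinuousAt (fun a : E => (a, c)) c := by fun_prop
  have hr : ContinuousAt (fun a : E => (c, a)) c := by fun_prop
  have hdm : ∀ᶠ p in 𝓝 (c, c), DifferentiableAt ℝ m p :=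
    (hm.eventually (by simp)).mono fun p hp => hp.differentiableAt (by simp)
  have hdC : ∀ᶠ p in 𝓝 (c, c), DifferentiableAt ℝ C p :=
    (hC.eventually (by simp)).mono fun p hp => hp.differentiableAt (by simp)
  -- partial derivatives in terms of the full derivative
  have hpart : ∀ {F : E × E → E} {a : E} (u : E), DifferentiableAt ℝ F (a, c) →
      fderiv ℝ (fun b => F (a, b)) c u = fderiv ℝ F (a, c) (0, u) := by
    intro F a u hF
    have := hF.hasFDerivAt.comp c (hasFDerivAt_prodMk_right (𝕜 := ℝ) a c)
    have h2 := congrArg (fun L => L u) this.fderiv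
    simpa [Function.comp_def] using h2
  have em : ∀ u : E, (fun a => fderiv ℝ (fun b => m (a, b)) c u) =ᶠ[𝓝 c]
      fun a => fderiv ℝ m (a, c) (0, u) := fun u =>
    (hl.eventually hdm).mono fun a ha => hpart u ha
  have eC : (fun a => fderiv ℝ (fun b => C (a, b)) c w) =ᶠ[𝓝 c]
      fun a => fderiv ℝ C (a, c) (0, w) :=
    (hl.eventually hdC).mono fun a ha => hpart w ha
  have hm' : DifferentiableAt ℝ (fderiv ℝ m) (c, c) :=
    (hm.fderiv_right (m := 1) (by norm_num)).differentiableAt (by simp)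
  have hC' : DifferentiableAt ℝ (fderiv ℝ C) (c, c) :=
    (hC.fderiv_right (m := 1) (by norm_num)).differentiableAt (by simp)
  set B := fderiv ℝ (fderiv ℝ m) (c, c) with hB
  have hsymm : ∀ p q, B p q = B q p :=
    (hm.isSymmSndFDerivAt (by simp)).eq
  have d1 : ∀ u : E, HasFDerivAt (fun a => fderiv ℝ m (a, c) (0, u))
      ((B.comp (ContinuousLinearMap.inl ℝ E E)).flip (0, u)) c := by
    intro u
    have := (hm'.hasFDerivAt.comp (f := fun a => (a, c)) c
      (hasFDerivAt_prodMk_left (𝕜 := ℝ) c c)).clm_apply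
      (hasFDerivAt_const (0, u) c)
    refine this.congr_fderiv ?_
    ext y; simp [B]
  have dC : DifferentiableAt ℝ (fun a => fderiv ℝ C (a, c) (0, w)) c := by
    have := (hC'.hasFDerivAt.comp (f := fun a => (a, c)) c
      (hasFDerivAt_prodMk_left (𝕜 := ℝ) c c)).clm_apply
      (hasFDerivAt_const (0, w) c)
    exact this.differentiableAt
  -- `m` is the identity in each variable when the other one is the unit
  have m0 : ∀ u, fderiv ℝ m (c, c) (0, u) = u := by
    intro u
    rw [← hpart u hdm.self_of_nhds, (show (fun b => m (c, b)) =ᶠ[𝓝 c] id from hm₂).fderiv_eq]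
    simp
  have m1 : ∀ u, fderiv ℝ m (c, c) (u, 0) = u := by
    intro u
    have := (hdm.self_of_nhds.hasFDerivAt.comp (f := fun a => (a, c)) c
      (hasFDerivAt_prodMk_left (𝕜 := ℝ) c c)).fderiv
    have e : m ∘ (fun a => (a, c)) =ᶠ[𝓝 c] id := hm₁
    rw [e.fderiv_eq] at this
    simpa using (congrArg (fun L => L u) this).symm
  -- derivative of `m (a, b) = m (C (a, b), a)` in `b` at `c`
  have key : (fun a => fderiv ℝ m (a, c) (0, w)) =ᶠ[𝓝 c]
      fun a => fderiv ℝ m (c, a) (fderiv ℝ C (a, c) (0, w), 0) := by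
    filter_upwards [hl.eventually hdm, hl.eventually hdC, hr.eventually hdm, hC₁,
      hl.eventually hmC.eventually_nhds] with a h1 h2 h3 h4 h5
    rw [← hpart w h1]
    have e : (fun b => m (a, b)) =ᶠ[𝓝 c] fun b => m (C (a, b), a) :=
      (show ContinuousAt (fun b : E => (a, b)) c by fun_prop).eventually h5
    rw [e.fderiv_eq]
    have h6 := h2.hasFDerivAt.comp c (hasFDerivAt_prodMk_right (𝕜 := ℝ) a c)
    have h7 := h6.prodMk (hasFDerivAt_const a c)
    have h3' : HasFDerivAt m (fderiv ℝ m (c, a)) (C (a, c), a) := by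
      rw [h4]; exact h3.hasFDerivAt
    have h8 := h3'.comp (f := fun b => (C (a, b), a)) c h7
    have h9 := congrArg (fun L => L w) h8.fderiv
    simpa [Function.comp_def] using h9
  have C0 : fderiv ℝ C (c, c) (0, w) = w := by
    have := key.self_of_nhds
    simp only [m0, m1] at this
    exact this.symm
  have d2 : HasFDerivAt (fun a => fderiv ℝ m (c, a) (fderiv ℝ C (a, c) (0, w), 0))
      ((B.comp (ContinuousLinearMap.inr ℝ E E)).flip (w, 0) +
        fderiv ℝ (fun a => fderiv ℝ C (a, c) (0, w)) c) c := by
    have := (hm'.hasFDerivAt.comp c (hasFDerivAt_prodMk_right (𝕜 := ℝ) c c)).clm_apply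
      (dC.hasFDerivAt.prodMk (hasFDerivAt_const (0 : E) c))
    refine this.congr_fderiv ?_
    ext y
    simp [B, C0, m1, add_comm]
  refine ⟨dC.congr_of_eventuallyEq eC, ?_⟩
  rw [eC.fderiv_eq, VectorField.lieBracket, (em w).fderiv_eq, (em v).fderiv_eq,
    hpart v hdm.self_of_nhds, hpart w hdm.self_of_nhds, m0, m0, (d1 w).fderiv, (d1 v).fderiv]
  have h := congrArg (fun L => L v) ((d1 w).unique (d2.congr_of_eventuallyEq key))
  simp only [ContinuousLinearMap.flip_apply, ContinuousLinearMap.comp_apply,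
    ContinuousLinearMap.inl_apply, add_apply,
    ContinuousLinearMap.inr_apply] at h ⊢
  rw [h, hsymm (0, v)]
  abel

end LocalGroup

/-! ### The differential of the adjoint representation -/

section AdjointRepresentation

open Filter Topology

variable {k : ℕ} {G : Type*} [TopologicalSpace G] [ChartedSpace (EuclideanSpace ℝ (Fin k)) G]
  [Group G]

variable (G) in
/-- Multiplication of `G` in the chart around `1`. -/
def chartMul (p : LieAlg k × LieAlg k) : LieAlg k :=
  extChartAt (𝓡 k) (1 : G)
    ((extChartAt (𝓡 k) (1 : G)).symm p.1 * (extChartAt (𝓡 k) (1 : G)).symm p.2)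

variable (G) in
/-- The conjugation `(a, b) ↦ a b a⁻¹` of `G` in the chart around `1`. -/
def chartConj (p : LieAlg k × LieAlg k) : LieAlg k :=
  extChartAt (𝓡 k) (1 : G)
    ((extChartAt (𝓡 k) (1 : G)).symm p.1 * (extChartAt (𝓡 k) (1 : G)).symm p.2 *
      ((extChartAt (𝓡 k) (1 : G)).symm p.1)⁻¹)

variable [LieGroup (𝓡 k) ∞ G]

variable (G) in
theorem contMDiffAt_extChartAt_one_symm :
    ContMDiffAt 𝓘(ℝ, LieAlg k) (𝓡 k) ∞ (extChartAt (𝓡 k) (1 : G)).symm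
      (extChartAt (𝓡 k) (1 : G) 1) :=
  (contMDiffOn_extChartAt_symm (1 : G)).contMDiffAt (extChartAt_target_mem_nhds 1)

variable (G) in
theorem contMDiffAt_extChartAt_one_symm_fst :
    ContMDiffAt 𝓘(ℝ, LieAlg k × LieAlg k) (𝓡 k) ∞
      (fun p : LieAlg k × LieAlg k => (extChartAt (𝓡 k) (1 : G)).symm p.1)
      (extChartAt (𝓡 k) (1 : G) 1, extChartAt (𝓡 k) (1 : G) 1) :=
  ContMDiffAt.comp _ (by exact contMDiffAt_extChartAt_one_symm G)
    contDiff_fst.contMDiff.contMDiffAt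

variable (G) in
theorem contMDiffAt_extChartAt_one_symm_snd :
    ContMDiffAt 𝓘(ℝ, LieAlg k × LieAlg k) (𝓡 k) ∞
      (fun p : LieAlg k × LieAlg k => (extChartAt (𝓡 k) (1 : G)).symm p.2)
      (extChartAt (𝓡 k) (1 : G) 1, extChartAt (𝓡 k) (1 : G) 1) :=
  ContMDiffAt.comp _ (by exact contMDiffAt_extChartAt_one_symm G)
    contDiff_snd.contMDiff.contMDiffAt

variable (G) in
theorem contDiffAt_chartMul : ContDiffAt ℝ ∞ (chartMul G (k := k))
    (extChartAt (𝓡 k) (1 : G) 1, extChartAt (𝓡 k) (1 : G) 1) := by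
  rw [← contMDiffAt_iff_contDiffAt]
  refine ContMDiffAt.comp (I' := 𝓡 k) _ ?_ ((contMDiffAt_extChartAt_one_symm_fst G).mul
    (contMDiffAt_extChartAt_one_symm_snd G))
  simpa using contMDiffAt_extChartAt (I := 𝓡 k) (n := ∞) (x := (1 : G))

variable (G) in
theorem contDiffAt_chartConj : ContDiffAt ℝ ∞ (chartConj G (k := k))
    (extChartAt (𝓡 k) (1 : G) 1, extChartAt (𝓡 k) (1 : G) 1) := by
  rw [← contMDiffAt_iff_contDiffAt]
  refine ContMDiffAt.comp (I' := 𝓡 k) _ ?_ (((contMDiffAt_extChartAt_one_symm_fst G).mul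
    (contMDiffAt_extChartAt_one_symm_snd G)).mul (contMDiffAt_extChartAt_one_symm_fst G).inv)
  simpa using contMDiffAt_extChartAt (I := 𝓡 k) (n := ∞) (x := (1 : G))

theorem mdifferentiable_conj (g : G) :
    MDifferentiable (𝓡 k) (𝓡 k) (fun y : G => g * y * g⁻¹) :=
  ((contMDiff_mul_left (I := 𝓡 k) (n := ∞) (a := g)).mul contMDiff_const).mdifferentiable (by simp)

/-- `Ad_g` is the derivative of the conjugation by `g`, read in the chart around `1`. -/
theorem adjointAction_eq_fderiv (g : G) :
    adjointAction g = fderiv ℝ (fun b => extChartAt (𝓡 k) (1 : G)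
      (g * (extChartAt (𝓡 k) (1 : G)).symm b * g⁻¹)) (extChartAt (𝓡 k) (1 : G) 1) := by
  have h := (mdifferentiable_conj (k := k) g) 1
  unfold adjointAction
  rw [h.mfderiv, ModelWithCorners.range_eq_univ, fderivWithin_univ]
  have : g * 1 * g⁻¹ = 1 := by simp
  simp only [writtenInExtChartAt, this]
  rfl

/-- The left-invariant vector field of `v`, read in the chart around `1`. -/
theorem mfderiv_extChartAt_mulInvariantVectorField (v : LieAlg k) {g : G}
    (hg : g ∈ (chartAt (EuclideanSpace ℝ (Fin k)) (1 : G)).source) :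
    mfderiv (𝓡 k) 𝓘(ℝ, LieAlg k) (extChartAt (𝓡 k) (1 : G)) g
      (mulInvariantVectorField (I := 𝓡 k) (G := G) v g) =
    fderiv ℝ (fun b => extChartAt (𝓡 k) (1 : G)
      (g * (extChartAt (𝓡 k) (1 : G)).symm b)) (extChartAt (𝓡 k) (1 : G) 1) v := by
  have : IsManifold (𝓡 k) 1 G := IsManifold.of_le (n := ∞) (by simp)
  have hg' : MDifferentiableAt (𝓡 k) 𝓘(ℝ, LieAlg k) (extChartAt (𝓡 k) (1 : G)) (g * 1) := by
    rw [mul_one]; exact mdifferentiableAt_extChartAt hg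
  have hm : MDifferentiableAt (𝓡 k) (𝓡 k) (fun b : G => g * b) 1 :=
    (contMDiff_mul_left (I := 𝓡 k) (n := ∞) (a := g)).mdifferentiable (by simp) 1
  have h := mfderiv_comp_apply (x := (1 : G)) hg' hm v
  have h2 : mfderiv (𝓡 k) 𝓘(ℝ, LieAlg k) (extChartAt (𝓡 k) (1 : G)) g
      (mulInvariantVectorField (I := 𝓡 k) (G := G) v g) =
      mfderiv (𝓡 k) 𝓘(ℝ, LieAlg k) (extChartAt (𝓡 k) (1 : G) ∘ fun b : G => g * b) 1 v := by
    refine Eq.trans ?_ h.symm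
    show mfderiv (𝓡 k) 𝓘(ℝ, LieAlg k) (extChartAt (𝓡 k) (1 : G)) g
      (mfderiv (𝓡 k) (𝓡 k) (fun b : G => g * b) 1 v) = _
    congr 2
    rw [mul_one]
  rw [h2, (hg'.comp (1 : G) hm).mfderiv, ModelWithCorners.range_eq_univ, fderivWithin_univ]
  rfl

/-- The bracket of `𝔤` is the Lie bracket of the left-invariant vector fields, read in the chart
around `1`. -/
theorem lieBr_eq_lieBracket (v w : LieAlg k) :
    lieBr G v w = VectorField.lieBracket ℝ
      (fun a => fderiv ℝ (fun b => chartMul G (a, b)) (extChartAt (𝓡 k) (1 : G) 1) v)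
      (fun a => fderiv ℝ (fun b => chartMul G (a, b)) (extChartAt (𝓡 k) (1 : G) 1) w)
      (extChartAt (𝓡 k) (1 : G) 1) := by
  have : IsManifold (𝓡 k) 1 G := IsManifold.of_le (n := ∞) (by simp)
  let P : LieAlg k → LieAlg k → LieAlg k := fun u =>
    VectorField.mpullbackWithin 𝓘(ℝ, LieAlg k) (𝓡 k) (extChartAt (𝓡 k) (1 : G)).symm
      (mulInvariantVectorField (I := 𝓡 k) (G := G) u) (Set.range (𝓡 k))
  have key : ∀ u : LieAlg k, P u =ᶠ[𝓝 (extChartAt (𝓡 k) (1 : G) 1)]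
      (fun a => fderiv ℝ (fun b => chartMul G (a, b)) (extChartAt (𝓡 k) (1 : G) 1) u) := by
    intro u
    filter_upwards [extChartAt_target_mem_nhds (I := 𝓡 k) (1 : G)] with a ha
    have h1 := mfderiv_extChartAt_comp_mfderivWithin_extChartAt_symm (I := 𝓡 k) ha
    have h2 := mfderivWithin_extChartAt_symm_comp_mfderiv_extChartAt (I := 𝓡 k) ha
    simp only [P]
    rw [VectorField.mpullbackWithin_apply, ContinuousLinearMap.inverse_eq h2 h1]
    refine mfderiv_extChartAt_mulInvariantVectorField u ?_
    simpa using (extChartAt (𝓡 k) (1 : G)).map_target ha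
  show VectorField.mlieBracket (𝓡 k) (mulInvariantVectorField (I := 𝓡 k) (G := G) v)
    (mulInvariantVectorField (I := 𝓡 k) (G := G) w) 1 = _
  rw [VectorField.mlieBracket, VectorField.mlieBracketWithin_apply, mfderiv_extChartAt_self]
  refine Eq.trans (b := VectorField.lieBracketWithin ℝ (P v) (P w)
    ((extChartAt (𝓡 k) (1 : G)).symm ⁻¹' Set.univ ∩ Set.range (𝓡 k))
    (extChartAt (𝓡 k) (1 : G) 1)) ?_ ?_
  · exact congrArg (fun L : LieAlg k →L[ℝ] LieAlg k => L _) (ContinuousLinearMap.inverse_id ..)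
  rw [Set.preimage_univ, Set.univ_inter, (𝓡 k).range_eq_univ, VectorField.lieBracketWithin_univ]
  exact Filter.EventuallyEq.lieBracket_vectorField_eq (key v) (key w)

/-- The differential of the adjoint representation: the derivative at `1` of `g ↦ Ad_g w` is
`v ↦ [v, w]`. -/
theorem hasMFDerivAt_adjointAction (w : LieAlg k) :
    ∃ L : LieAlg k →L[ℝ] LieAlg k, (∀ v, L v = lieBr G v w) ∧
      HasMFDerivAt (𝓡 k) 𝓘(ℝ, LieAlg k) (fun g : G => adjointAction g w) 1 L := by
  have : IsManifold (𝓡 k) 1 G := IsManifold.of_le (n := ∞) (by simp)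
  set c : LieAlg k := extChartAt (𝓡 k) (1 : G) 1 with hc
  have hs : (extChartAt (𝓡 k) (1 : G)).symm c = 1 := extChartAt_to_inv 1
  have ht := extChartAt_target_mem_nhds (I := 𝓡 k) (1 : G)
  have hd := fun v => fderiv_conj_eq_lieBracket (c := c)
    ((contDiffAt_chartMul G).of_le ENat.LEInfty.out)
    ((contDiffAt_chartConj G).of_le ENat.LEInfty.out)
    (by
      filter_upwards [ht] with a ha
      rw [chartMul, hs, mul_one]
      exact (extChartAt (𝓡 k) (1 : G)).right_inv ha)
    (by
      filter_upwards [ht] with a ha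
      rw [chartMul, hs, one_mul]
      exact (extChartAt (𝓡 k) (1 : G)).right_inv ha)
    (Eventually.of_forall fun a => by rw [chartConj, hs, mul_one, mul_inv_cancel, hc])
    (by
      -- the chart is injective at `a b a⁻¹` when `a` and `b` are close to `1`
      have h1 := (contMDiffAt_extChartAt_one_symm_fst (k := k) G).continuousAt
      have h2 := (contMDiffAt_extChartAt_one_symm_snd (k := k) G).continuousAt
      have : IsTopologicalGroup G := topologicalGroup_of_lieGroup (𝓡 k) ∞
      have h3 := (h1.mul h2).mul h1.inv
      have h4 : (extChartAt (𝓡 k) (1 : G)).source ∈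
          𝓝 ((extChartAt (𝓡 k) (1 : G)).symm c * (extChartAt (𝓡 k) (1 : G)).symm c *
            ((extChartAt (𝓡 k) (1 : G)).symm c)⁻¹) := by
        rw [hs]
        simpa using extChartAt_source_mem_nhds (I := 𝓡 k) (1 : G)
      filter_upwards [h3.eventually h4] with p hp
      have hp' := (extChartAt (𝓡 k) (1 : G)).left_inv hp
      simp only [Pi.mul_apply, Pi.inv_apply] at hp'
      simp only [chartMul, chartConj, hp', inv_mul_cancel_right]) v w
  have e : (fun g : G => adjointAction g w) =ᶠ[𝓝 1]
      (fun a => fderiv ℝ (fun b => chartConj G (a, b)) c w) ∘ extChartAt (𝓡 k) (1 : G) := by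
    filter_upwards [extChartAt_source_mem_nhds (I := 𝓡 k) (1 : G)] with g hg
    rw [adjointAction_eq_fderiv, Function.comp_apply]
    simp only [chartConj, (extChartAt (𝓡 k) (1 : G)).left_inv hg, hc]
  have hφ : MDifferentiableAt (𝓡 k) 𝓘(ℝ, LieAlg k) (extChartAt (𝓡 k) (1 : G)) 1 :=
    mdifferentiableAt_extChartAt (mem_chart_source _ 1)
  refine ⟨_, fun v => (hd v).2.trans (lieBr_eq_lieBracket v w).symm, ?_⟩
  have h1 := HasMFDerivAt.comp (1 : G) (hd 0).1.hasFDerivAt.hasMFDerivAt hφ.hasMFDerivAt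
  rw [mfderiv_extChartAt_self] at h1
  exact h1.congr_of_eventuallyEq e

end AdjointRepresentation

/-! ### Equivariance of the moment map -/

section MomentMap

open Filter Topology

theorem isLocallyConstant_of_hasMFDerivAt_zero {k : ℕ} {G : Type*} [TopologicalSpace G]
    [ChartedSpace (EuclideanSpace ℝ (Fin k)) G] [IsManifold (𝓡 k) 1 G] {u : G → ℝ}
    (hu : ∀ g, HasMFDerivAt (𝓡 k) 𝓘(ℝ, ℝ) u g
      (0 : EuclideanSpace ℝ (Fin k) →L[ℝ] ℝ)) : IsLocallyConstant u := by
  rw [IsLocallyConstant.iff_eventually_eq]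
  intro p
  obtain ⟨r, hr, hball⟩ := Metric.mem_nhds_iff.1 (extChartAt_target_mem_nhds (I := 𝓡 k) p)
  have hd : ∀ y ∈ Metric.ball (extChartAt (𝓡 k) p p) r,
      HasFDerivAt (u ∘ (extChartAt (𝓡 k) p).symm) (0 : EuclideanSpace ℝ (Fin k) →L[ℝ] ℝ) y := by
    intro y hy
    have hs : MDifferentiableAt 𝓘(ℝ, EuclideanSpace ℝ (Fin k)) (𝓡 k)
        (extChartAt (𝓡 k) p).symm y :=
      ((contMDiffOn_extChartAt_symm (n := 1) p).mdifferentiableOn (by simp)).mdifferentiableAt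
        ((isOpen_extChartAt_target p).mem_nhds (hball hy))
    have := (hu _).comp y hs.hasMFDerivAt
    rw [hasMFDerivAt_iff_hasFDerivAt] at this
    refine this.congr_fderiv ?_
    exact ContinuousLinearMap.zero_comp _
  have hconst : ∀ y ∈ Metric.ball (extChartAt (𝓡 k) p p) r,
      u ((extChartAt (𝓡 k) p).symm y) = u ((extChartAt (𝓡 k) p).symm (extChartAt (𝓡 k) p p)) :=
    fun y hy => Metric.isOpen_ball.is_const_of_fderiv_eq_zero
      (convex_ball _ _).isPreconnected
      (fun z hz => (hd z hz).differentiableAt.differentiableWithinAt)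
      (fun z hz => (hd z hz).fderiv) hy (Metric.mem_ball_self hr)
  filter_upwards [extChartAt_source_mem_nhds (I := 𝓡 k) p,
    (continuousAt_extChartAt (I := 𝓡 k) p).eventually (Metric.ball_mem_nhds _ hr)] with q hq hq'
  have := hconst _ hq'
  rwa [(extChartAt (𝓡 k) p).left_inv hq,
    (extChartAt (𝓡 k) p).left_inv (mem_extChartAt_source p)] at this

section LieGroup
variable {k : ℕ} {G : Type*} [TopologicalSpace G] [ChartedSpace (EuclideanSpace ℝ (Fin k)) G]
  [Group G]

theorem adjointAction_one :
    adjointAction (k := k) (1 : G) = ContinuousLinearMap.id ℝ (LieAlg k) := by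
  have e : (fun y : G => 1 * y * 1⁻¹) = id := by ext y; simp
  rw [adjointAction, e]
  exact mfderiv_id

theorem coadjointAction_one (μ : LieCoalg k) : coadjointAction (1 : G) μ = μ := by
  rw [coadjointAction, inv_one, adjointAction_one]
  exact μ.comp_id

variable [LieGroup (𝓡 k) ∞ G]

theorem adjointAction_mul_apply (g h : G) (v : LieAlg k) :
    adjointAction (g * h) v = adjointAction g (adjointAction h v) := by
  have e : (fun y : G => g * h * y * (g * h)⁻¹) =
      (fun y : G => g * y * g⁻¹) ∘ (fun y : G => h * y * h⁻¹) := by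
    ext y; simp [mul_assoc]
  have hc := mfderiv_comp_apply (x := (1 : G)) (mdifferentiable_conj (k := k) g (h * 1 * h⁻¹))
    (mdifferentiable_conj (k := k) h 1) v
  rw [← e] at hc
  have h1 : h * 1 * h⁻¹ = 1 := by simp
  refine Eq.trans hc ?_
  exact congrArg (fun p : G => (mfderiv (𝓡 k) (𝓡 k) (fun y : G => g * y * g⁻¹) p :
    LieAlg k →L[ℝ] LieAlg k) (adjointAction h v)) h1

theorem lieBr_skew (v w : LieAlg k) : lieBr G v w = -lieBr G w v := by
  have : LieGroup (𝓡 k) (minSmoothness ℝ 3) G :=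
    LieGroup.of_le (n := ∞) (by
      rw [minSmoothness_of_isRCLikeNormedField]
      exact (ENat.LEInfty.out : (3 : WithTop ℕ∞) ≤ ∞))
  exact (lie_skew (show GroupLieAlgebra (𝓡 k) G from v)
    (show GroupLieAlgebra (𝓡 k) G from w)).symm

end LieGroup

section Action
variable {k d : ℕ} {G : Type*} [TopologicalSpace G] [ChartedSpace (EuclideanSpace ℝ (Fin k)) G]
  [Group G] {M : Type*} [TopologicalSpace M] [ChartedSpace (EuclideanSpace ℝ (Fin d)) M]
  [MulAction G M]

/-- The chain rule for the orbit map `g ↦ g • x` at `1`. -/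
theorem hasMFDerivAt_comp_smul [ContMDiffSMul (𝓡 k) (𝓡 d) ∞ G M]
    {V : Type*} [NormedAddCommGroup V] [NormedSpace ℝ V] {F : M → V} {x : M}
    {F' : EuclideanSpace ℝ (Fin d) →L[ℝ] V}
    (hF : HasMFDerivAt (𝓡 d) 𝓘(ℝ, V) F x F') :
    HasMFDerivAt (𝓡 k) 𝓘(ℝ, V) (fun g : G => F (g • x)) 1
      (F'.comp (infinitesimalAction G x)) := by
  have hs : MDifferentiableAt (𝓡 k) (𝓡 d) (fun g : G => g • x) 1 :=
    ((contMDiff_id (n := ∞)).smul contMDiff_const).mdifferentiable (by simp) 1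
  have hF1 : HasMFDerivAt (𝓡 d) 𝓘(ℝ, V) F ((1 : G) • x) F' := by
    rw [one_smul]; exact hF
  exact hF1.comp (1 : G) hs.hasMFDerivAt

variable {Ω : SymplecticForm d M} {Φ : C^∞⟮𝓡 d, M; 𝓘(ℝ, LieCoalg k), LieCoalg k⟯}

/-- The derivative of `f_η` along the generator `sgrad f_ξ` is `{f_η, f_ξ} = f_[η, ξ]`. -/
theorem IsHamiltonianAction.differential_infinitesimalAction (hΦ : IsHamiltonianAction G Ω Φ)
    (x : M) (ξ η : LieAlg k) :
    differential (d := d) (fun y => Φ y η) x (infinitesimalAction G x ξ) = Φ x (lieBr G η ξ) := by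
  rw [hΦ.generator, hΦ.bracket, SymplecticForm.poisson, SymplecticForm.sgrad]
  exact (Ω.form_sharp x _ _).symm

/-- The differential of a map into a normed space `V`, with its values in `V` itself instead of
the tangent spaces of `V`. -/
def vectorDifferential {V : Type*} [NormedAddCommGroup V] [NormedSpace ℝ V] (F : M → V) (x : M) :
    TangentSpace (𝓡 d) x →L[ℝ] V :=
  mfderiv (𝓡 d) 𝓘(ℝ, V) F x

theorem differential_comp {V : Type*} [NormedAddCommGroup V] [NormedSpace ℝ V]
    {x : M} {F : M → V} (hF : MDifferentiableAt (𝓡 d) 𝓘(ℝ, V) F x) {g : V → ℝ}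
    (hg : DifferentiableAt ℝ g (F x)) (v : TangentSpace (𝓡 d) x) :
    differential (d := d) (fun y => g (F y)) x v = fderiv ℝ g (F x) (vectorDifferential F x v) := by
  have := mfderiv_comp_apply (x := x) hg.mdifferentiableAt hF v
  rw [mfderiv_eq_fderiv] at this
  exact this

theorem vectorDifferential_apply {Φ : M → LieCoalg k} {x : M}
    (hΦ : MDifferentiableAt (𝓡 d) 𝓘(ℝ, LieCoalg k) Φ x) (η : LieAlg k)
    (v : TangentSpace (𝓡 d) x) :
    vectorDifferential Φ x v η = differential (d := d) (fun y => Φ y η) x v := by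
  rw [differential_comp hΦ (g := fun α : LieCoalg k => α η) (by fun_prop),
    (ContinuousLinearMap.apply ℝ ℝ η).hasFDerivAt.fderiv (f := fun α : LieCoalg k => α η)]
  rfl

variable [LieGroup (𝓡 k) ∞ G]

/-- The two terms of the derivative of `g ↦ Φ(g x)(Ad_g η)` at `1` in the direction `ξ` are
`{f_η, f_ξ}(x) = Φ(x)([η, ξ])` and `Φ(x)([ξ, η])`; they cancel. -/
theorem IsHamiltonianAction.hasMFDerivAt_pairing (hΦ : IsHamiltonianAction G Ω Φ)
    (x : M) (η : LieAlg k) :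
    HasMFDerivAt (𝓡 k) 𝓘(ℝ, ℝ) (fun g : G => Φ (g • x) (adjointAction g η)) 1
      (0 : EuclideanSpace ℝ (Fin k) →L[ℝ] ℝ) := by
  have := hΦ.smooth
  have hΦd : MDifferentiableAt (𝓡 d) 𝓘(ℝ, LieCoalg k) Φ x := Φ.contMDiff.mdifferentiable (by simp) x
  have h1 := hasMFDerivAt_comp_smul (k := k) (G := G) hΦd.hasMFDerivAt
  obtain ⟨L, hL, h2⟩ := hasMFDerivAt_adjointAction (G := G) η
  have h3 : HasMFDerivAt (𝓡 k) 𝓘(ℝ, LieCoalg k × LieAlg k)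
      (fun g : G => (Φ (g • x), adjointAction g η)) 1 _ :=
    ⟨h1.1.prodMk h2.1, h1.2.prodMk h2.2⟩
  have hev := (isBoundedBilinearMap_apply (𝕜 := ℝ) (E := LieAlg k) (F := ℝ)).hasFDerivAt
    (Φ ((1 : G) • x), adjointAction (1 : G) η)
  have h4 := hev.hasMFDerivAt.comp (1 : G) h3
  have key : ∀ ξ : LieAlg k, Φ ((1 : G) • x) (L ξ) +
      vectorDifferential Φ x (infinitesimalAction (d := d) G x ξ) (adjointAction (1 : G) η) =
        0 := by
    intro ξ
    rw [adjointAction_one, one_smul, hL, lieBr_skew, map_neg, ContinuousLinearMap.id_apply,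
      vectorDifferential_apply hΦd, hΦ.differential_infinitesimalAction]
    exact neg_add_cancel _
  exact h4.congr_mfderiv (ContinuousLinearMap.ext key)

/-- The moment map of a connected group is equivariant: by `hasMFDerivAt_pairing` at the point
`g • x`, translated from `1` to `g`, the function `g ↦ Φ(g x)(Ad_g η)` is locally constant. -/
theorem IsHamiltonianAction.map_smul [ConnectedSpace G] (hΦ : IsHamiltonianAction G Ω Φ)
    (g : G) (x : M) : Φ (g • x) = coadjointAction g (Φ x) := by
  have : IsManifold (𝓡 k) 1 G := IsManifold.of_le (n := ∞) (by simp)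
  have key : ∀ (η : LieAlg k) (g : G), Φ (g • x) (adjointAction g η) = Φ x η := by
    intro η g
    have hloc : IsLocallyConstant (fun g : G => Φ (g • x) (adjointAction g η)) := by
      refine isLocallyConstant_of_hasMFDerivAt_zero (k := k) fun g => ?_
      have h1 := hΦ.hasMFDerivAt_pairing (g • x) (adjointAction g η)
      -- right translation by `g⁻¹` moves the point `g` to `1`
      have hr : MDifferentiableAt (𝓡 k) (𝓡 k) (fun y : G => y * g⁻¹) g :=
        (contMDiff_mul_right (I := 𝓡 k) (n := ∞) (a := g⁻¹)).mdifferentiable (by simp) g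
      rw [← mul_inv_cancel g] at h1
      have h2 := h1.comp g hr.hasMFDerivAt
      have e : (fun g : G => Φ (g • x) (adjointAction g η)) =
          (fun h : G => Φ (h • g • x) (adjointAction h (adjointAction g η))) ∘
            fun y => y * g⁻¹ := by
        funext y
        simp only [Function.comp_apply]
        rw [← adjointAction_mul_apply, smul_smul, inv_mul_cancel_right]
      rw [e]
      exact h2.congr_mfderiv (ContinuousLinearMap.zero_comp _)
    have := hloc.apply_eq_of_preconnectedSpace g 1
    rwa [one_smul, adjointAction_one] at this
  ext η
  have := key (adjointAction g⁻¹ η) g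
  rw [← adjointAction_mul_apply, mul_inv_cancel, adjointAction_one] at this
  exact this
end Action

end MomentMap

/-! ### Smoothness of the Poisson bracket -/

section PoissonSmooth

open Filter Topology

/-- A continuous alternating 2-form as a continuous bilinear form. -/
def alternatingToBilinear {E : Type*} [NormedAddCommGroup E] [NormedSpace ℝ E]
    [FiniteDimensional ℝ E] (σ : E [⋀^Fin 2]→L[ℝ] ℝ) : E →L[ℝ] E →L[ℝ] ℝ :=
  have update_one (v u : E) : Function.update ![v, 0] 1 u = ![v, u] := by
    funext i; fin_cases i <;> rfl
  (LinearMap.mk₂ ℝ (fun v w => σ ![v, w])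
    (fun v v' w => σ.toMultilinearMap.cons_add ![w] v v')
    (fun c v w => σ.toMultilinearMap.cons_smul ![w] c v)
    (fun v w w' => by
      have h := σ.toMultilinearMap.map_update_add ![v, 0] 1 w w'
      rwa [update_one, update_one, update_one] at h)
    (fun c v w => by
      have h := σ.toMultilinearMap.map_update_smul ![v, 0] 1 c w
      rwa [update_one, update_one] at h)).toContinuousBilinearMap

theorem alternatingToBilinear_apply {E : Type*} [NormedAddCommGroup E] [NormedSpace ℝ E]
    [FiniteDimensional ℝ E] (σ : E [⋀^Fin 2]→L[ℝ] ℝ) (v w : E) :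
    alternatingToBilinear σ v w = σ ![v, w] := rfl

variable {d : ℕ} {M : Type*} [TopologicalSpace M] [ChartedSpace (EuclideanSpace ℝ (Fin d)) M]

/-- The derivative of the inverse of the chart around `x₀`, as a map from the model space: it sends
a vector of coordinates at `y` to a tangent vector of `M`. -/
def chartFrame (x₀ : M) (y : EuclideanSpace ℝ (Fin d)) :
    EuclideanSpace ℝ (Fin d) →L[ℝ] TangentSpace (𝓡 d) ((extChartAt (𝓡 d) x₀).symm y) :=
  mfderiv 𝓘(ℝ, EuclideanSpace ℝ (Fin d)) (𝓡 d) (extChartAt (𝓡 d) x₀).symm y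

theorem differential_chartFrame [IsManifold (𝓡 d) 1 M] {f : M → ℝ} {x₀ : M}
    {y : EuclideanSpace ℝ (Fin d)} (hy : y ∈ (extChartAt (𝓡 d) x₀).target)
    (hf : MDifferentiableAt (𝓡 d) 𝓘(ℝ, ℝ) f ((extChartAt (𝓡 d) x₀).symm y))
    (v : EuclideanSpace ℝ (Fin d)) :
    differential f ((extChartAt (𝓡 d) x₀).symm y)
      (chartFrame x₀ y v) =
    fderiv ℝ (fun z => f ((extChartAt (𝓡 d) x₀).symm z)) y v := by
  have hs : MDifferentiableAt 𝓘(ℝ, EuclideanSpace ℝ (Fin d)) (𝓡 d)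
      (extChartAt (𝓡 d) x₀).symm y :=
    ((contMDiffOn_extChartAt_symm (n := 1) x₀).mdifferentiableOn (by simp)).mdifferentiableAt
      ((isOpen_extChartAt_target x₀).mem_nhds hy)
  have := mfderiv_comp_apply (x := y) hf hs v
  rw [mfderiv_eq_fderiv] at this
  exact this.symm

namespace SymplecticForm
variable (Ω : SymplecticForm d M)

theorem poisson_eq_differential_sgrad (f g : M → ℝ) (x : M) :
    Ω.poisson f g x = differential f x (Ω.sgrad g x) :=
  Ω.form_sharp x _ _

theorem poisson_swap (f g : M → ℝ) (x : M) : Ω.poisson f g x = -Ω.poisson g f x :=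
  Ω.form_swap x _ _

theorem localForm_apply (x₀ : M) (y v w : EuclideanSpace ℝ (Fin d)) :
    localForm Ω.form x₀ y ![v, w] = Ω.form ((extChartAt (𝓡 d) x₀).symm y)
      ![chartFrame x₀ y v, chartFrame x₀ y w] := by
  refine congrArg (Ω.form ((extChartAt (𝓡 d) x₀).symm y)) ?_
  funext i
  fin_cases i <;> rfl

variable [IsManifold (𝓡 d) ∞ M]

theorem bijective_chartFrame {x₀ : M} {y : EuclideanSpace ℝ (Fin d)}
    (hy : y ∈ (extChartAt (𝓡 d) x₀).target) :
    Function.Bijective (chartFrame x₀ y) := by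
  have : IsManifold (𝓡 d) 1 M := IsManifold.of_le (n := ∞) (by simp)
  have h := isInvertible_mfderivWithin_extChartAt_symm (I := 𝓡 d) hy
  rw [(𝓡 d).range_eq_univ, mfderivWithin_univ] at h
  exact h.bijective

theorem isInvertible_localForm (x₀ : M) {y : EuclideanSpace ℝ (Fin d)}
    (hy : y ∈ (extChartAt (𝓡 d) x₀).target) :
    (alternatingToBilinear (localForm Ω.form x₀ y)).IsInvertible := by
  obtain ⟨hD, hD'⟩ := bijective_chartFrame hy
  have hinj : Function.Injective
      (alternatingToBilinear (localForm Ω.form x₀ y)).toLinearMap := by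
    rw [← LinearMap.ker_eq_bot, LinearMap.ker_eq_bot']
    intro v hv
    refine hD ((Ω.nondegenerate _ _ fun w => ?_).trans (map_zero _).symm)
    obtain ⟨u, rfl⟩ := hD' w
    rw [← localForm_apply]
    exact congrArg (fun L : EuclideanSpace ℝ (Fin d) →L[ℝ] ℝ => L u) hv
  have hdim : Module.finrank ℝ (EuclideanSpace ℝ (Fin d)) =
      Module.finrank ℝ (EuclideanSpace ℝ (Fin d) →L[ℝ] ℝ) := by
    rw [← (LinearMap.toContinuousLinearMap
      (𝕜 := ℝ) (E := EuclideanSpace ℝ (Fin d)) (F' := ℝ)).finrank_eq]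
    exact Subspace.dual_finrank_eq.symm
  exact ⟨(LinearMap.linearEquivOfInjective _ hinj hdim).toContinuousLinearEquiv, by ext; rfl⟩

/-- The coordinate expression of the Poisson bracket: `df` applied to the vector that the form
turns into `dg`. -/
theorem poisson_eq_chart {f g : M → ℝ} (hf : MDifferentiable (𝓡 d) 𝓘(ℝ, ℝ) f)
    (hg : MDifferentiable (𝓡 d) 𝓘(ℝ, ℝ) g) (x₀ : M) {y : EuclideanSpace ℝ (Fin d)}
    (hy : y ∈ (extChartAt (𝓡 d) x₀).target) :
    Ω.poisson f g ((extChartAt (𝓡 d) x₀).symm y) =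
      fderiv ℝ (fun z => f ((extChartAt (𝓡 d) x₀).symm z)) y
        ((alternatingToBilinear (localForm Ω.form x₀ y)).inverse
          (fderiv ℝ (fun z => g ((extChartAt (𝓡 d) x₀).symm z)) y)) := by
  have : IsManifold (𝓡 d) 1 M := IsManifold.of_le (n := ∞) (by simp)
  obtain ⟨w, hw⟩ := (bijective_chartFrame hy).2
    (Ω.sgrad g ((extChartAt (𝓡 d) x₀).symm y))
  have hfl : alternatingToBilinear (localForm Ω.form x₀ y) w =
      fderiv ℝ (fun z => g ((extChartAt (𝓡 d) x₀).symm z)) y := by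
    ext u
    rw [← differential_chartFrame hy (hg _), alternatingToBilinear_apply,
      localForm_apply, hw]
    exact Ω.form_sharp _ _ _
  obtain ⟨e, he⟩ := Ω.isInvertible_localForm x₀ hy
  rw [← hfl, ← he, ContinuousLinearMap.inverse_equiv, ContinuousLinearEquiv.coe_coe,
    ContinuousLinearEquiv.coe_coe, ContinuousLinearEquiv.symm_apply_apply,
    ← differential_chartFrame hy (hf _), hw, poisson_eq_differential_sgrad]

/-- The Poisson bracket of smooth functions is smooth, because inversion of continuous linear maps
is smooth at invertible maps. -/
theorem contMDiff_poisson {f g : M → ℝ} (hf : ContMDiff (𝓡 d) 𝓘(ℝ, ℝ) ∞ f)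
    (hg : ContMDiff (𝓡 d) 𝓘(ℝ, ℝ) ∞ g) : ContMDiff (𝓡 d) 𝓘(ℝ, ℝ) ∞ (Ω.poisson f g) := by
  intro x₀
  have hopen := isOpen_extChartAt_target (I := 𝓡 d) x₀
  set y₀ := extChartAt (𝓡 d) x₀ x₀ with hy₀
  have hy₀t : y₀ ∈ (extChartAt (𝓡 d) x₀).target := mem_extChartAt_target x₀
  have hloc : ∀ {F : M → ℝ}, ContMDiff (𝓡 d) 𝓘(ℝ, ℝ) ∞ F →
      ContDiffAt ℝ ∞ (fderiv ℝ fun z => F ((extChartAt (𝓡 d) x₀).symm z)) y₀ := by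
    intro F hF
    have h1 := hF.comp_contMDiffOn (contMDiffOn_extChartAt_symm (n := ∞) x₀)
    have h2 := (h1.contMDiffAt (hopen.mem_nhds hy₀t)).contDiffAt
    exact h2.fderiv_right (m := ∞) (by simp)
  have hform : ContDiffAt ℝ ∞ (fun y => alternatingToBilinear (localForm Ω.form x₀ y)) y₀ := by
    refine ContDiffOn.contDiffAt (s := (extChartAt (𝓡 d) x₀).target) ?_ (hopen.mem_nhds hy₀t)
    refine contDiffOn_clm_apply.2 fun v => contDiffOn_clm_apply.2 fun w => ?_
    exact (ContinuousAlternatingMap.apply ℝ _ ℝ ![v, w]).contDiff.comp_contDiffOn (Ω.smooth x₀)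
  have hinv := ((Ω.isInvertible_localForm x₀ hy₀t).contDiffAt_map_inverse (n := ∞)).comp y₀ hform
  have hchart : ContDiffAt ℝ ∞ (fun y => fderiv ℝ (fun z => f ((extChartAt (𝓡 d) x₀).symm z)) y
        ((alternatingToBilinear (localForm Ω.form x₀ y)).inverse
          (fderiv ℝ (fun z => g ((extChartAt (𝓡 d) x₀).symm z)) y))) y₀ :=
    (hloc hf).clm_apply (hinv.clm_apply (hloc hg))
  refine (hchart.contMDiffAt.comp x₀ (contMDiffAt_extChartAt (n := ∞))).congr_of_eventuallyEq ?_
  filter_upwards [extChartAt_source_mem_nhds (I := 𝓡 d) x₀] with x hx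
  have h := Ω.poisson_eq_chart (hf.mdifferentiable (by simp)) (hg.mdifferentiable (by simp)) x₀
    ((extChartAt (𝓡 d) x₀).map_source hx)
  rw [(extChartAt (𝓡 d) x₀).left_inv hx] at h
  exact h

end SymplecticForm

end PoissonSmooth

/-! ### Linear algebra of coisotropic subspaces -/

section Coisotropic

/-- The rank of the restriction of a form to a subspace, given as the range of `ρ`, is the
dimension of the subspace minus that of its radical. The rank is computed on the source of `ρ`. -/
theorem finrank_inf_orthogonal {𝔤 V : Type*} [AddCommGroup 𝔤] [Module ℝ 𝔤]
    [AddCommGroup V] [Module ℝ V] [FiniteDimensional ℝ 𝔤] [FiniteDimensional ℝ V]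
    (B : LinearMap.BilinForm ℝ V) (hB : B.IsRefl) (ρ : 𝔤 →ₗ[ℝ] V) :
    Module.finrank ℝ ↥(LinearMap.range ρ ⊓ B.orthogonal (LinearMap.range ρ)) +
      Module.finrank ℝ (LinearMap.range (B.compl₁₂ ρ ρ)) =
        Module.finrank ℝ (LinearMap.range ρ) := by
  have h1 := LinearMap.finrank_range_add_finrank_ker ρ
  have h2 := LinearMap.finrank_range_add_finrank_ker (B.compl₁₂ ρ ρ)
  have hk : LinearMap.ker (B.compl₁₂ ρ ρ) = (B.orthogonal (LinearMap.range ρ)).comap ρ := by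
    ext ξ
    simp only [LinearMap.mem_ker, Submodule.mem_comap, LinearMap.BilinForm.mem_orthogonal_iff]
    constructor
    · rintro h _ ⟨η, rfl⟩
      exact hB _ _ (by simpa using congrArg (fun L => L η) h)
    · intro h
      ext η
      exact hB _ _ (h _ ⟨η, rfl⟩)
  have h3 := LinearMap.finrank_range_add_finrank_ker (ρ.domRestrict (LinearMap.ker (B.compl₁₂ ρ ρ)))
  have h4 : LinearMap.range (ρ.domRestrict (LinearMap.ker (B.compl₁₂ ρ ρ))) =
      LinearMap.range ρ ⊓ B.orthogonal (LinearMap.range ρ) := by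
    rw [LinearMap.range_domRestrict, hk, Submodule.map_comap_eq]
  have hle : LinearMap.ker ρ ≤ LinearMap.ker (B.compl₁₂ ρ ρ) := by
    intro ξ hξ
    ext η
    simp [LinearMap.mem_ker.1 hξ]
  have h5 : Module.finrank ℝ (LinearMap.ker (ρ.domRestrict (LinearMap.ker (B.compl₁₂ ρ ρ)))) =
      Module.finrank ℝ (LinearMap.ker ρ) := by
    rw [LinearMap.ker_domRestrict]
    exact (Submodule.submoduleOfEquivOfLe hle).finrank_eq
  rw [h4, h5] at h3
  omega

/-- Let `T` be a subspace of a symplectic space on which the form has rank `2l`, and let `E ⊆ T` be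
an isotropic subspace of dimension `l` that meets the orthogonal of `T` in `0`. Then
`L = E + T^⊥` is coisotropic, so the radical of the form on `L` is `L^⊥`: the image of `E` in the
symplectic space `T / (T ∩ T^⊥)` of dimension `2l` is Lagrangian, whence
`L^⊥ = E^⊥ ∩ T = E + (T ∩ T^⊥) ⊆ L`. Here `T` is the range of `ρ`, `E` is the span of the `ρ(c_i)`,
and its dimension and position are encoded by the independence of the functionals
`η ↦ B(ρ(c_i), ρ(η))`. -/
theorem finrank_span_sup_orthogonal {𝔤 V : Type*} [AddCommGroup 𝔤] [Module ℝ 𝔤]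
    [AddCommGroup V] [Module ℝ V] [FiniteDimensional ℝ 𝔤] [FiniteDimensional ℝ V]
    (B : LinearMap.BilinForm ℝ V) (hB : B.Nondegenerate) (hA : B.IsRefl)
    (ρ : 𝔤 →ₗ[ℝ] V) {l : ℕ} (c : Fin l → 𝔤)
    (hrank : Module.finrank ℝ (LinearMap.range (B.compl₁₂ ρ ρ)) = 2 * l)
    (hiso : ∀ i j, B (ρ (c i)) (ρ (c j)) = 0)
    (hind : LinearIndependent ℝ fun i => B.compl₁₂ ρ ρ (c i)) :
    let T := LinearMap.range ρ
    let L := Submodule.span ℝ (Set.range fun i => ρ (c i)) ⊔ B.orthogonal T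
    l ≤ Module.finrank ℝ T ∧
    Module.finrank ℝ T ≤ Module.finrank ℝ V ∧
    Module.finrank ℝ L = Module.finrank ℝ V - Module.finrank ℝ T + l ∧
    Module.finrank ℝ ↥(L ⊓ B.orthogonal L) = Module.finrank ℝ T - l := by
  intro T L
  set E := Submodule.span ℝ (Set.range fun i => ρ (c i)) with hE
  have hET : E ≤ T := by
    rw [hE, Submodule.span_le]
    rintro _ ⟨i, rfl⟩
    exact ⟨c i, rfl⟩
  have hEi : LinearIndependent ℝ fun i => ρ (c i) :=
    LinearIndependent.of_comp (B.compl₂ ρ) (by exact hind)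
  have hEdim : Module.finrank ℝ E = l := by
    rw [hE, finrank_span_eq_card hEi, Fintype.card_fin]
  have hdisj : E ⊓ B.orthogonal T = ⊥ := by
    rw [eq_bot_iff]
    rintro v ⟨hv, hv'⟩
    obtain ⟨a, rfl⟩ := (Submodule.mem_span_range_iff_exists_fun ℝ).1 hv
    have h0 : ∑ i, a i • B.compl₁₂ ρ ρ (c i) = 0 := by
      ext η
      have := hA _ _ (hv' (ρ η) ⟨η, rfl⟩)
      simpa using this
    have := Fintype.linearIndependent_iff.1 hind a h0
    simp [this]
  have h1 := B.finrank_orthogonal hB T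
  have hTV := Submodule.finrank_le T
  have h2 := Submodule.finrank_sup_add_finrank_inf_eq E (B.orthogonal T)
  rw [hdisj, finrank_bot, hEdim, h1] at h2
  have h3 := finrank_inf_orthogonal B hA ρ
  rw [hrank] at h3
  change Module.finrank ℝ ↥(T ⊓ B.orthogonal T) + 2 * l = Module.finrank ℝ T at h3
  have h4 := Submodule.finrank_sup_add_finrank_inf_eq E (T ⊓ B.orthogonal T)
  have h5 : E ⊓ (T ⊓ B.orthogonal T) = ⊥ := by
    rw [eq_bot_iff, ← hdisj]
    exact inf_le_inf_left _ inf_le_right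
  rw [h5, finrank_bot, hEdim] at h4
  have h6 := B.finrank_orthogonal hB L
  have hN : E ⊔ (T ⊓ B.orthogonal T) ≤ B.orthogonal L := by
    have hEE : ∀ v ∈ E, ∀ w ∈ E, B v w = 0 := by
      intro v hv w hw
      have h7 : E ≤ B.orthogonal E := by
        conv_lhs => rw [hE]
        rw [Submodule.span_le]
        rintro _ ⟨j, rfl⟩ w hw
        have h8 : E ≤ LinearMap.ker (B.flip (ρ (c j))) := by
          rw [hE, Submodule.span_le]
          rintro _ ⟨i, rfl⟩
          exact hiso i j
        exact h8 hw
      exact h7 hw v hv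
    have hTT : ∀ v ∈ B.orthogonal T, ∀ w ∈ T, B v w = 0 := fun v hv w hw => hA _ _ (hv w hw)
    refine sup_le ?_ ?_
    · intro w hw v hv
      obtain ⟨e, he, t, ht, rfl⟩ := Submodule.mem_sup.1 hv
      show B (e + t) w = 0
      rw [map_add, LinearMap.add_apply, hEE e he w hw, hTT t ht w (hET hw), add_zero]
    · rintro w ⟨hw, hw'⟩ v hv
      obtain ⟨e, he, t, ht, rfl⟩ := Submodule.mem_sup.1 hv
      have := hw' e (hET he)
      show B (e + t) w = 0
      rw [map_add, LinearMap.add_apply, hTT t ht w hw, add_zero]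
      exact this
  have h2' : Module.finrank ℝ L = l + (Module.finrank ℝ V - Module.finrank ℝ T) := h2
  -- the inclusion is an equality for dimension reasons
  have hN' : E ⊔ (T ⊓ B.orthogonal T) = B.orthogonal L := by
    apply Submodule.eq_of_le_of_finrank_eq hN
    omega
  have hL : B.orthogonal L ≤ L := by
    rw [← hN']
    exact sup_le_sup_left inf_le_right _
  rw [inf_eq_right.2 hL]
  omega

end Coisotropic

/-! ### Poisson brackets and differentials of generated algebras -/

section PoissonAlgebra

variable {d : ℕ} {M : Type*} [TopologicalSpace M] [ChartedSpace (EuclideanSpace ℝ (Fin d)) M]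

theorem differential_add (f g : C^∞⟮𝓡 d, M; ℝ⟯) (x : M) :
    differential (d := d) (f + g : C^∞⟮𝓡 d, M; ℝ⟯) x = differential f x + differential g x :=
  mfderiv_add (f.contMDiff.mdifferentiable (by simp) x) (g.contMDiff.mdifferentiable (by simp) x)

theorem differential_smul (c : ℝ) (f : C^∞⟮𝓡 d, M; ℝ⟯) (x : M) :
    differential (d := d) (c • f : C^∞⟮𝓡 d, M; ℝ⟯) x = c • differential f x :=
  const_smul_mfderiv (f.contMDiff.mdifferentiable (by simp) x) c

theorem differential_mul (f g : C^∞⟮𝓡 d, M; ℝ⟯) (x : M) :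
    differential (d := d) (f * g : C^∞⟮𝓡 d, M; ℝ⟯) x =
      f x • differential g x + g x • differential f x :=
  ((f.contMDiff.mdifferentiable (by simp) x).hasMFDerivAt.mul
    (g.contMDiff.mdifferentiable (by simp) x).hasMFDerivAt).mfderiv

theorem differential_algebraMap (c : ℝ) (x : M) :
    differential (d := d) (algebraMap ℝ C^∞⟮𝓡 d, M; ℝ⟯ c) x = 0 :=
  mfderiv_const

theorem differentialSpan_span (s : Set C^∞⟮𝓡 d, M; ℝ⟯) (x : M) :
    differentialSpan (Submodule.span ℝ s) x =
      Submodule.span ℝ ((fun f : C^∞⟮𝓡 d, M; ℝ⟯ => differential f x) '' s) := by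
  refine le_antisymm (Submodule.span_le.2 ?_) (Submodule.span_mono ?_)
  · rintro _ ⟨f, hf, rfl⟩
    induction hf using Submodule.span_induction with
    | mem f hf => exact Submodule.subset_span ⟨f, hf, rfl⟩
    | zero =>
      have := differential_smul 0 (0 : C^∞⟮𝓡 d, M; ℝ⟯) x
      rw [zero_smul, zero_smul] at this
      exact this ▸ Submodule.zero_mem _
    | add f g _ _ hf hg =>
      exact differential_add f g x ▸ Submodule.add_mem _ hf hg
    | smul c f _ hf =>
      exact differential_smul c f x ▸ Submodule.smul_mem _ c hf
  · rintro _ ⟨f, hf, rfl⟩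
    exact ⟨f, Submodule.subset_span hf, rfl⟩

/-- By the Leibniz rule, passing to the algebra generated by functions adds no new differentials. -/
theorem differentialSpan_adjoin (s : Set C^∞⟮𝓡 d, M; ℝ⟯) (x : M) :
    differentialSpan (Subalgebra.toSubmodule (Algebra.adjoin ℝ s)) x =
      Submodule.span ℝ ((fun f : C^∞⟮𝓡 d, M; ℝ⟯ => differential f x) '' s) := by
  refine le_antisymm (Submodule.span_le.2 ?_) (Submodule.span_mono ?_)
  · rintro _ ⟨f, hf, rfl⟩
    rw [Subalgebra.mem_toSubmodule] at hf
    induction hf using Algebra.adjoin_induction with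
    | mem f hf => exact Submodule.subset_span ⟨f, hf, rfl⟩
    | algebraMap c => exact differential_algebraMap (d := d) (M := M) c x ▸ Submodule.zero_mem _
    | add f g _ _ hf hg =>
      exact differential_add f g x ▸ Submodule.add_mem _ hf hg
    | mul f g _ _ hf hg =>
      exact differential_mul f g x ▸
        Submodule.add_mem _ (Submodule.smul_mem _ _ hg) (Submodule.smul_mem _ _ hf)
  · rintro _ ⟨f, hf, rfl⟩
    exact ⟨f, Algebra.subset_adjoin hf, rfl⟩

namespace SymplecticForm
variable (Ω : SymplecticForm d M) [IsManifold (𝓡 d) ∞ M]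

/-- The Poisson bracket of smooth functions as a bilinear map. -/
def poissonMap : C^∞⟮𝓡 d, M; ℝ⟯ →ₗ[ℝ] C^∞⟮𝓡 d, M; ℝ⟯ →ₗ[ℝ] C^∞⟮𝓡 d, M; ℝ⟯ :=
  LinearMap.mk₂ ℝ (fun f g => ⟨Ω.poisson f g, Ω.contMDiff_poisson f.contMDiff g.contMDiff⟩)
    (fun f f' g => by
      ext x
      show Ω.poisson _ g x = Ω.poisson f g x + Ω.poisson f' g x
      simp only [poisson_eq_differential_sgrad]
      rw [differential_add]; rfl)
    (fun c f g => by
      ext x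
      show Ω.poisson _ g x = c * Ω.poisson f g x
      simp only [poisson_eq_differential_sgrad]
      rw [differential_smul]; rfl)
    (fun f g g' => by
      ext x
      show Ω.poisson f _ x = Ω.poisson f g x + Ω.poisson f g' x
      rw [poisson_swap, Ω.poisson_swap f g, Ω.poisson_swap f g', ← neg_add]
      simp only [poisson_eq_differential_sgrad]
      rw [differential_add]; rfl)
    (fun c f g => by
      ext x
      show Ω.poisson f _ x = c * Ω.poisson f g x
      rw [poisson_swap, Ω.poisson_swap f g, mul_neg]
      simp only [poisson_eq_differential_sgrad]
      rw [differential_smul]; rfl)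

theorem poissonMap_apply (f g : C^∞⟮𝓡 d, M; ℝ⟯) (x : M) :
    Ω.poissonMap f g x = Ω.poisson f g x := rfl

theorem poissonMap_swap (f g : C^∞⟮𝓡 d, M; ℝ⟯) : Ω.poissonMap f g = -Ω.poissonMap g f := by
  ext x
  exact Ω.poisson_swap f g x

theorem poissonMap_mul_left (f f' g : C^∞⟮𝓡 d, M; ℝ⟯) :
    Ω.poissonMap (f * f') g = f * Ω.poissonMap f' g + f' * Ω.poissonMap f g := by
  ext x
  show Ω.poisson _ g x = f x * Ω.poisson f' g x + f' x * Ω.poisson f g x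
  simp only [poisson_eq_differential_sgrad]
  rw [differential_mul]; rfl

theorem poissonMap_algebraMap_left (c : ℝ) (g : C^∞⟮𝓡 d, M; ℝ⟯) :
    Ω.poissonMap (algebraMap ℝ _ c) g = 0 := by
  ext x
  show Ω.poisson _ g x = 0
  rw [poisson_eq_differential_sgrad, differential_algebraMap]; rfl

theorem poissonMap_mem_span {s : Set C^∞⟮𝓡 d, M; ℝ⟯}
    (hs : ∀ f ∈ s, ∀ g ∈ s, Ω.poissonMap f g ∈ Submodule.span ℝ s) {f g : C^∞⟮𝓡 d, M; ℝ⟯}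
    (hf : f ∈ Submodule.span ℝ s) (hg : g ∈ Submodule.span ℝ s) :
    Ω.poissonMap f g ∈ Submodule.span ℝ s := by
  have h1 : ∀ f ∈ s, Submodule.span ℝ s ≤ (Submodule.span ℝ s).comap (Ω.poissonMap f) :=
    fun f hf => Submodule.span_le.2 fun g hg => hs f hf g hg
  have h2 : Submodule.span ℝ s ≤ (Submodule.span ℝ s).comap (Ω.poissonMap.flip g) :=
    Submodule.span_le.2 fun f hf => h1 f hf hg
  exact h2 hf

theorem poissonMap_mem_adjoin_of_left {s : Set C^∞⟮𝓡 d, M; ℝ⟯} {A : Subalgebra ℝ C^∞⟮𝓡 d, M; ℝ⟯}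
    (hsA : Algebra.adjoin ℝ s ≤ A) {g : C^∞⟮𝓡 d, M; ℝ⟯} (hs : ∀ f ∈ s, Ω.poissonMap f g ∈ A)
    {f : C^∞⟮𝓡 d, M; ℝ⟯} (hf : f ∈ Algebra.adjoin ℝ s) : Ω.poissonMap f g ∈ A := by
  induction hf using Algebra.adjoin_induction with
  | mem f hf => exact hs f hf
  | algebraMap c => exact Ω.poissonMap_algebraMap_left c g ▸ A.zero_mem
  | add f f' _ _ hf hf' =>
    rw [map_add]
    exact A.add_mem hf hf'
  | mul f f' hfs hfs' hf hf' =>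
    rw [poissonMap_mul_left]
    exact A.add_mem (A.mul_mem (hsA hfs) hf') (A.mul_mem (hsA hfs') hf)

theorem poissonMap_mem_adjoin {s : Set C^∞⟮𝓡 d, M; ℝ⟯}
    (hs : ∀ f ∈ s, ∀ g ∈ s, Ω.poissonMap f g ∈ Algebra.adjoin ℝ s) {f g : C^∞⟮𝓡 d, M; ℝ⟯}
    (hf : f ∈ Algebra.adjoin ℝ s) (hg : g ∈ Algebra.adjoin ℝ s) :
    Ω.poissonMap f g ∈ Algebra.adjoin ℝ s := by
  refine Ω.poissonMap_mem_adjoin_of_left le_rfl (fun f hf => ?_) hf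
  rw [poissonMap_swap]
  refine Subalgebra.neg_mem _ (Ω.poissonMap_mem_adjoin_of_left le_rfl (fun g hg => ?_) hg)
  exact hs g hg f hf

theorem poissonMap_eq_zero_of_mem_adjoin {s : Set C^∞⟮𝓡 d, M; ℝ⟯} {h : C^∞⟮𝓡 d, M; ℝ⟯}
    (hs : ∀ f ∈ s, Ω.poissonMap h f = 0) {f : C^∞⟮𝓡 d, M; ℝ⟯} (hf : f ∈ Algebra.adjoin ℝ s) :
    Ω.poissonMap h f = 0 := by
  rw [poissonMap_swap, neg_eq_zero]
  induction hf using Algebra.adjoin_induction with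
  | mem f hf => rw [poissonMap_swap, hs f hf, neg_zero]
  | algebraMap c => exact Ω.poissonMap_algebraMap_left c h
  | add f f' _ _ hf hf' => rw [map_add, LinearMap.add_apply, hf, hf', add_zero]
  | mul f f' _ _ hf hf' => rw [poissonMap_mul_left, hf, hf', mul_zero, mul_zero, add_zero]

end SymplecticForm

section Action
variable {k : ℕ} {G : Type*} [TopologicalSpace G] [ChartedSpace (EuclideanSpace ℝ (Fin k)) G]
  [Group G] [MulAction G M] {Ω : SymplecticForm d M}
  {Φ : C^∞⟮𝓡 d, M; 𝓘(ℝ, LieCoalg k), LieCoalg k⟯}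

/-- Invariant functions are constant along the orbits. -/
theorem differential_invariant [LieGroup (𝓡 k) ∞ G] [ContMDiffSMul (𝓡 k) (𝓡 d) ∞ G M]
    {u : C^∞⟮𝓡 d, M; ℝ⟯}
    (hu : u ∈ invariantFunctions d G M) (x : M) (ξ : LieAlg k) :
    differential (d := d) u x (infinitesimalAction G x ξ) = 0 := by
  have h1 := hasMFDerivAt_comp_smul (k := k) (G := G)
    (u.contMDiff.mdifferentiable (by simp) x).hasMFDerivAt
  have e : (fun g : G => u (g • x)) = fun _ => u x := funext fun g => hu g x
  rw [e] at h1
  have h2 := h1.mfderiv.symm.trans mfderiv_const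
  exact congrArg (fun L : LieAlg k →L[ℝ] ℝ => L ξ) h2

theorem IsHamiltonianAction.sgrad_invariant_smul (hΦ : IsHamiltonianAction G Ω Φ)
    {u : C^∞⟮𝓡 d, M; ℝ⟯} (hu : u ∈ invariantFunctions d G M) (g : G) (x : M) :
    Ω.sgrad u (g • x) = mfderiv (𝓡 d) (𝓡 d) (fun y : M => g • y) x (Ω.sgrad u x) := by
  have := hΦ.smooth
  set D : TangentSpace (𝓡 d) x →L[ℝ] TangentSpace (𝓡 d) (g • x) :=
    mfderiv (𝓡 d) (𝓡 d) (fun y : M => g • y) x with hD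
  have hs : MDifferentiableAt (𝓡 d) (𝓡 d) (fun y : M => g • y) x :=
    ((contMDiff_const (n := ∞) (I' := 𝓡 k) (c := g)).smul contMDiff_id).mdifferentiable (by simp) x
  have hdu : ∀ v, differential u (g • x) (D v) = differential u x v := by
    intro v
    have h1 := mfderiv_comp_apply (x := x)
      (u.contMDiff.mdifferentiable (by simp) (g • x)) hs v
    have e : u ∘ (fun y : M => g • y) = u := funext fun y => hu g y
    rw [e] at h1
    exact h1.symm
  have hinj : Function.Injective D.toLinearMap := by
    rw [← LinearMap.ker_eq_bot, LinearMap.ker_eq_bot']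
    intro v hv
    refine Ω.nondegenerate x v fun w => ?_
    rw [← hΦ.symplectic g x v w]
    have hv' : D v = 0 := hv
    rw [← hD, hv']
    rw [← Ω.flat_apply, map_zero]
    rfl
  have hsurj : Function.Surjective D.toLinearMap :=
    (LinearMap.injective_iff_surjective_of_finrank_eq_finrank (by rfl)).1 hinj
  have key : differential u (g • x) = Ω.flat (g • x) (D (Ω.sgrad u x)) := by
    ext w
    obtain ⟨v, rfl⟩ := hsurj w
    refine (hdu v).trans ?_
    refine Eq.trans ?_ (hΦ.symplectic g x (Ω.sgrad u x) v).symm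
    exact (Ω.form_sharp x _ v).symm
  rw [SymplecticForm.sgrad, key]
  exact (LinearEquiv.ofBijective (Ω.flat (g • x)) (Ω.flat_bijective (g • x))).symm_apply_apply _

/-- At `x`, the function `F ∘ Φ` has the same differential as `f_ξ` with the constant
`ξ = dF(Φ(x))`. -/
theorem differential_comp_moment (F : C^∞⟮𝓘(ℝ, LieCoalg k), LieCoalg k; ℝ⟯)
    (x : M) : differential (d := d) (F.comp Φ) x =
      differential (fun y => Φ y (coalgDifferential F (Φ x))) x := by
  have hΦd : MDifferentiableAt (𝓡 d) 𝓘(ℝ, LieCoalg k) Φ x := Φ.contMDiff.mdifferentiable (by simp) x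
  ext v
  rw [← vectorDifferential_apply hΦd, apply_coalgDifferential]
  exact differential_comp hΦd (F.contMDiff.contDiff.differentiable (by simp) _) v

/-- The Hamiltonian vector field of `F ∘ Φ` is tangent to the orbits of `G`. -/
theorem IsHamiltonianAction.sgrad_comp_moment (hΦ : IsHamiltonianAction G Ω Φ)
    (F : C^∞⟮𝓘(ℝ, LieCoalg k), LieCoalg k; ℝ⟯) (x : M) :
    Ω.sgrad (F.comp Φ) x = infinitesimalAction G x (coalgDifferential F (Φ x)) := by
  rw [hΦ.generator, SymplecticForm.sgrad, differential_comp_moment]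
  rfl

variable [IsManifold (𝓡 d) ∞ M]

theorem IsHamiltonianAction.poissonMap_mem_invariantFunctions (hΦ : IsHamiltonianAction G Ω Φ)
    {u v : C^∞⟮𝓡 d, M; ℝ⟯} (hu : u ∈ invariantFunctions d G M)
    (hv : v ∈ invariantFunctions d G M) : Ω.poissonMap u v ∈ invariantFunctions d G M := by
  intro g x
  show Ω.poisson u v (g • x) = Ω.poisson u v x
  rw [SymplecticForm.poisson, hΦ.sgrad_invariant_smul hu, hΦ.sgrad_invariant_smul hv,
    hΦ.symplectic]
  rfl

/-- The moment map is a Poisson map. -/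
theorem IsHamiltonianAction.poissonMap_comp_moment (hΦ : IsHamiltonianAction G Ω Φ)
    (F K : C^∞⟮𝓘(ℝ, LieCoalg k), LieCoalg k; ℝ⟯) (x : M) :
    Ω.poissonMap (F.comp Φ) (K.comp Φ) x = liePoisson G F K (Φ x) := by
  rw [liePoisson, hΦ.bracket, SymplecticForm.poissonMap_apply, SymplecticForm.poisson,
    hΦ.sgrad_comp_moment, hΦ.sgrad_comp_moment, hΦ.generator, hΦ.generator]
  rfl

variable [LieGroup (𝓡 k) ∞ G]

theorem IsHamiltonianAction.poissonMap_invariant_comp_moment (hΦ : IsHamiltonianAction G Ω Φ)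
    {u : C^∞⟮𝓡 d, M; ℝ⟯} (hu : u ∈ invariantFunctions d G M)
    (F : C^∞⟮𝓘(ℝ, LieCoalg k), LieCoalg k; ℝ⟯) : Ω.poissonMap u (F.comp Φ) = 0 := by
  have := hΦ.smooth
  ext x
  rw [SymplecticForm.poissonMap_apply, SymplecticForm.poisson_eq_differential_sgrad,
    hΦ.sgrad_comp_moment, differential_invariant hu]
  rfl

end Action

end PoissonAlgebra

/-! ### General points and dimensions -/

section GeneralPoints

section General
variable {X : Type*} [TopologicalSpace X]

theorem ForGeneral.and {P Q : X → Prop} (hP : ForGeneral P) (hQ : ForGeneral Q) :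
    ForGeneral fun x => P x ∧ Q x := by
  obtain ⟨U, hU, hUd, hP⟩ := hP
  obtain ⟨V, hV, hVd, hQ⟩ := hQ
  exact ⟨U ∩ V, hU.inter hV, hUd.inter_of_isOpen_left hVd hU, fun x hx => ⟨hP x hx.1, hQ x hx.2⟩⟩

theorem ForGeneral.mono {P Q : X → Prop} (hP : ForGeneral P) (h : ∀ x, P x → Q x) :
    ForGeneral Q := by
  obtain ⟨U, hU, hUd, hP⟩ := hP
  exact ⟨U, hU, hUd, fun x hx => h x (hP x hx)⟩

theorem ForGeneral.exists [Nonempty X] {P : X → Prop} (hP : ForGeneral P) : ∃ x, P x := by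
  obtain ⟨U, -, hUd, hP⟩ := hP
  obtain ⟨x, hx⟩ := hUd.nonempty
  exact ⟨x, hP x hx⟩

end General

section LieAlgebra
variable {k : ℕ} (G : Type*) [TopologicalSpace G] [ChartedSpace (EuclideanSpace ℝ (Fin k)) G]
  [Group G] [LieGroup (𝓡 k) ∞ G]

/-- The Lie bracket of `𝔤` as a continuous bilinear map. -/
def adjointRepresentation : LieAlg k →L[ℝ] LieAlg k →L[ℝ] LieAlg k :=
  LinearMap.toContinuousLinearMap
    { toFun := adOp G
      map_add' := fun ξ ξ' => by
        ext1 η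
        simp only [adOp_apply, add_apply]
        rw [lieBr_skew, lieBr_skew ξ, lieBr_skew ξ', ← neg_add]
        exact congrArg Neg.neg ((adOp G η).map_add ξ ξ')
      map_smul' := fun c ξ => by
        ext1 η
        simp only [adOp_apply, smul_apply, RingHom.id_apply]
        rw [lieBr_skew, lieBr_skew ξ, smul_neg]
        exact congrArg Neg.neg ((adOp G η).map_smul c ξ) }

variable {G}

theorem continuous_coalgDifferential {F : LieCoalg k → ℝ} (hF : ContDiff ℝ ∞ F) :
    Continuous (coalgDifferential F) := by
  have := hF.continuous_fderiv (by simp)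
  unfold coalgDifferential
  fun_prop

theorem mem_coadjointOrbitTangent_iff {ν α : LieCoalg k} :
    α ∈ coadjointOrbitTangent G ν ↔ ∃ ξ, ν.comp (adOp G ξ) = α := by
  let L : LieAlg k →ₗ[ℝ] LieCoalg k :=
    ((ContinuousLinearMap.compL ℝ (LieAlg k) (LieAlg k) ℝ ν).comp
      (adjointRepresentation G)).toLinearMap
  have h : coadjointOrbitTangent G ν = LinearMap.range L := by
    rw [← Submodule.span_eq (LinearMap.range L), LinearMap.coe_range]
    rfl
  rw [h, LinearMap.mem_range]
  rfl

/-- The value of `dF(ν)` at the tangent vector `ν([ξ, ·])` of the orbit is `-ν([dF(ν), ξ])`, so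
independence of the `dF_i(ν)` on the orbit can be expressed by covectors `ν([dF_i(ν), ·])` that
depend continuously on `ν`. -/
theorem linearIndependent_coadjoint_of_domRestrict {ι : Type*} [Fintype ι]
    {F : ι → LieCoalg k → ℝ} {ν : LieCoalg k}
    (h : LinearIndependent ℝ fun i =>
      (fderiv ℝ (F i) ν).toLinearMap.domRestrict (coadjointOrbitTangent G ν)) :
    LinearIndependent ℝ fun i => ν.comp (adOp G (coalgDifferential (F i) ν)) := by
  rw [Fintype.linearIndependent_iff] at h ⊢
  intro a ha
  refine h a ?_
  ext ⟨α, hα⟩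
  obtain ⟨ξ, rfl⟩ := mem_coadjointOrbitTangent_iff.1 hα
  have h1 := congrArg (fun L : LieCoalg k => L ξ) ha
  simp only [sum_apply, smul_apply, ContinuousLinearMap.comp_apply,
    adOp_apply, zero_apply] at h1
  simp only [LinearMap.sum_apply, LinearMap.smul_apply, LinearMap.domRestrict_apply,
    ContinuousLinearMap.coe_coe, ← apply_coalgDifferential, LinearMap.zero_apply,
    ContinuousLinearMap.comp_apply, adOp_apply]
  simp only [lieBr_skew ξ, map_neg, smul_neg, Finset.sum_neg_distrib]
  rw [h1, neg_zero]

theorem isOpen_linearIndependent_coadjoint {ι : Type*} [Finite ι] {F : ι → LieCoalg k → ℝ}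
    (hF : ∀ i, ContDiff ℝ ∞ (F i)) :
    IsOpen {ν : LieCoalg k |
      LinearIndependent ℝ fun i => ν.comp (adOp G (coalgDifferential (F i) ν))} := by
  have hc : Continuous fun (ν : LieCoalg k) (i : ι) =>
      ν.comp (adjointRepresentation G (coalgDifferential (F i) ν)) := by
    refine continuous_pi fun i => ?_
    have := continuous_coalgDifferential (hF i)
    fun_prop
  exact isOpen_setOfPred_linearIndependent.preimage hc

end LieAlgebra

section Action
variable {k d : ℕ} {G : Type*} [TopologicalSpace G] [ChartedSpace (EuclideanSpace ℝ (Fin k)) G]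
  [Group G] [LieGroup (𝓡 k) ∞ G] {M : Type*} [TopologicalSpace M]
  [ChartedSpace (EuclideanSpace ℝ (Fin d)) M]
  [MulAction G M] {Ω : SymplecticForm d M}
  {Φ : C^∞⟮𝓡 d, M; 𝓘(ℝ, LieCoalg k), LieCoalg k⟯}

/-- Independence at general points of general coadjoint orbits is independence at `Φ(x)` for general
`x ∈ M`: the condition on `x` is open, and, the moment map being equivariant, it holds at `g • x`
for group elements `g` arbitrarily close to `1`. -/
theorem IsHamiltonianAction.forGeneral_linearIndependent [ConnectedSpace G]
    (hΦ : IsHamiltonianAction G Ω Φ) {ι : Type*} [Fintype ι]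
    {F : ι → LieCoalg k → ℝ} (hF : ∀ i, ContDiff ℝ ∞ (F i))
    (h : ForGeneral fun x : M => ForGeneral fun g : G => LinearIndependent ℝ fun i =>
      (fderiv ℝ (F i) (coadjointAction g (Φ x))).toLinearMap.domRestrict
        (coadjointOrbitTangent G (coadjointAction g (Φ x)))) :
    ForGeneral fun x : M =>
      LinearIndependent ℝ fun i => (Φ x).comp (adOp G (coalgDifferential (F i) (Φ x))) := by
  have := hΦ.smooth
  refine ⟨_, (isOpen_linearIndependent_coadjoint (G := G) hF).preimage Φ.contMDiff.continuous, ?_,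
    fun x hx => hx⟩
  obtain ⟨U, -, hU, h⟩ := h
  rw [← dense_closure]
  refine hU.mono fun x hx => ?_
  obtain ⟨V, -, hV, h⟩ := h x hx
  have hcont : Continuous fun g : G => g • x :=
    ((contMDiff_id (n := ∞) (I := 𝓡 k)).smul (I' := 𝓡 d) contMDiff_const).continuous
  have h1 := hcont.closure_preimage_subset
    (Φ ⁻¹' {ν : LieCoalg k |
      LinearIndependent ℝ fun i => ν.comp (adOp G (coalgDifferential (F i) ν))})
  have h2 : V ⊆ (fun g : G => g • x) ⁻¹' (Φ ⁻¹' {ν : LieCoalg k |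
      LinearIndependent ℝ fun i => ν.comp (adOp G (coalgDifferential (F i) ν))}) := by
    intro g hg
    show LinearIndependent ℝ fun i =>
      (Φ (g • x)).comp (adOp G (coalgDifferential (F i) (Φ (g • x))))
    rw [hΦ.map_smul]
    exact linearIndependent_coadjoint_of_domRestrict (h g hg)
  -- `x = 1 • x` is a limit of points `g • x` with `g ∈ V`
  have h3 : (1 : G) ∈ closure V := hV 1
  have h4 := h1 (closure_mono h2 h3)
  simpa using h4

end Action

section Pointwise
variable {k d : ℕ} {G : Type*} [TopologicalSpace G] [ChartedSpace (EuclideanSpace ℝ (Fin k)) G]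
  [Group G] {M : Type*} [TopologicalSpace M]
  [ChartedSpace (EuclideanSpace ℝ (Fin d)) M]

namespace SymplecticForm
variable (Ω : SymplecticForm d M) (x : M)

/-- The symplectic form at `x` as a bilinear form. -/
def bilinForm : LinearMap.BilinForm ℝ (TangentSpace (𝓡 d) x) :=
  (LinearMap.toContinuousLinearMap
    (𝕜 := ℝ) (E := TangentSpace (𝓡 d) x) (F' := ℝ)).symm.toLinearMap ∘ₗ Ω.flat x

theorem bilinForm_apply (v w : TangentSpace (𝓡 d) x) : Ω.bilinForm x v w = Ω.form x ![v, w] := rfl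

theorem bilinForm_isRefl : (Ω.bilinForm x).IsRefl := fun v w h => by
  rw [bilinForm_apply, form_swap, neg_eq_zero]
  exact h

theorem bilinForm_nondegenerate : (Ω.bilinForm x).Nondegenerate := by
  refine (Ω.bilinForm_isRefl x).nondegenerate_iff_separatingLeft.2 fun v h => ?_
  exact Ω.nondegenerate x v h

theorem map_sharp_cobracketKernel (V : Submodule ℝ (TangentSpace (𝓡 d) x →L[ℝ] ℝ)) :
    (cobracketKernel Ω x V).map (Ω.sharp x).toLinearMap =
      V.map (Ω.sharp x).toLinearMap ⊓
        (Ω.bilinForm x).orthogonal (V.map (Ω.sharp x).toLinearMap) := by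
  ext v
  obtain ⟨α, rfl⟩ := (Ω.sharp x).surjective v
  have hmem : ∀ (W : Submodule ℝ (TangentSpace (𝓡 d) x →L[ℝ] ℝ)),
      Ω.sharp x α ∈ W.map (Ω.sharp x).toLinearMap ↔ α ∈ W := fun W =>
    ⟨fun ⟨β, hβ, h⟩ => (Ω.sharp x).injective h ▸ hβ, fun h => ⟨α, h, rfl⟩⟩
  rw [Submodule.mem_inf, hmem, hmem]
  refine and_congr_right fun _ => ?_
  constructor
  · rintro h _ ⟨β, hβ, rfl⟩
    exact Ω.bilinForm_isRefl x _ _ (h β hβ)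
  · intro h β hβ
    exact Ω.bilinForm_isRefl x _ _ (h _ ⟨β, hβ, rfl⟩)

theorem map_sharp_annihilator (T : Submodule ℝ (TangentSpace (𝓡 d) x))
    {V : Submodule ℝ (TangentSpace (𝓡 d) x →L[ℝ] ℝ)}
    (hV : (V : Set (TangentSpace (𝓡 d) x →L[ℝ] ℝ)) = {α | ∀ v ∈ T, α v = 0}) :
    V.map (Ω.sharp x).toLinearMap = (Ω.bilinForm x).orthogonal T := by
  ext v
  obtain ⟨α, rfl⟩ := (Ω.sharp x).surjective v
  have hα : α ∈ V ↔ ∀ v ∈ T, α v = 0 := by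
    rw [← SetLike.mem_coe, hV]; rfl
  have hmem : Ω.sharp x α ∈ V.map (Ω.sharp x).toLinearMap ↔ α ∈ V :=
    ⟨fun ⟨β, hβ, h⟩ => (Ω.sharp x).injective h ▸ hβ, fun h => ⟨α, h, rfl⟩⟩
  rw [hmem, hα]
  refine forall₂_congr fun v _ => ?_
  rw [← Ω.form_sharp x α v]
  exact ⟨fun h => Ω.bilinForm_isRefl x _ _ h, fun h => Ω.bilinForm_isRefl x _ _ h⟩

end SymplecticForm

variable [MulAction G M] {Ω : SymplecticForm d M}
  {Φ : C^∞⟮𝓡 d, M; 𝓘(ℝ, LieCoalg k), LieCoalg k⟯}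

theorem IsHamiltonianAction.form_infinitesimalAction (hΦ : IsHamiltonianAction G Ω Φ) (x : M)
    (ξ η : LieAlg k) :
    Ω.form x ![infinitesimalAction G x ξ, infinitesimalAction G x η] = Φ x (lieBr G ξ η) := by
  rw [hΦ.bracket, hΦ.generator, hΦ.generator]
  rfl

/-- The dimensions of the span `V` of the differentials at `x` of the `f_i ∘ Φ` and of the invariant
functions, and of the radical of the Poisson structure on it. The symplectic form identifies `V`
with `E + T^⊥`, where `T = T_x(G·x)` and `E` is spanned by the generators of `df_i(Φ(x))`, so
`finrank_span_sup_orthogonal` applies. -/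
theorem IsHamiltonianAction.finrank_differentialSpan [LieGroup (𝓡 k) ∞ G]
    (hΦ : IsHamiltonianAction G Ω Φ) {l : ℕ}
    (f : Fin l → C^∞⟮𝓘(ℝ, LieCoalg k), LieCoalg k; ℝ⟯) {x : M}
    (hinv : (differentialSpan (invariantFunctions d G M) x :
        Set (TangentSpace (𝓡 d) x →L[ℝ] ℝ)) =
      {α | ∀ v ∈ orbitTangent k d G x, α v = 0})
    (hdim : Module.finrank ℝ (coadjointOrbitTangent G (Φ x)) = 2 * l)
    (hcomm : ∀ i j, liePoisson G (f i) (f j) (Φ x) = 0)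
    (hind : LinearIndependent ℝ fun i => (Φ x).comp (adOp G (coalgDifferential (f i) (Φ x))))
    {V : Submodule ℝ (TangentSpace (𝓡 d) x →L[ℝ] ℝ)}
    (hV : V = Submodule.span ℝ ((fun u : C^∞⟮𝓡 d, M; ℝ⟯ => differential u x) ''
      ((Set.range fun i => (f i).comp Φ) ∪ invariantFunctions d G M))) :
    l ≤ Module.finrank ℝ (orbitTangent k d G x) ∧
    Module.finrank ℝ (orbitTangent k d G x) ≤ d ∧
    Module.finrank ℝ V = d - Module.finrank ℝ (orbitTangent k d G x) + l ∧
    Module.finrank ℝ (cobracketKernel Ω x V) = Module.finrank ℝ (orbitTangent k d G x) - l := by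
  let ρ : LieAlg k →ₗ[ℝ] TangentSpace (𝓡 d) x := (infinitesimalAction G x).toLinearMap
  let B := Ω.bilinForm x
  let e := LinearMap.toContinuousLinearMap (𝕜 := ℝ) (E := LieAlg k) (F' := ℝ)
  have hρ : ∀ ξ, e (B.compl₁₂ ρ ρ ξ) = (Φ x).comp (adOp G ξ) := fun ξ =>
    ContinuousLinearMap.ext fun η => hΦ.form_infinitesimalAction x ξ η
  have hrank : Module.finrank ℝ (LinearMap.range (B.compl₁₂ ρ ρ)) = 2 * l := by
    have : (LinearMap.range (B.compl₁₂ ρ ρ)).map e.toLinearMap = coadjointOrbitTangent G (Φ x) := by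
      ext α
      rw [mem_coadjointOrbitTangent_iff]
      constructor
      · rintro ⟨_, ⟨ξ, rfl⟩, rfl⟩
        exact ⟨ξ, (hρ ξ).symm⟩
      · rintro ⟨ξ, rfl⟩
        exact ⟨_, ⟨ξ, rfl⟩, hρ ξ⟩
    rw [← hdim, ← this]
    exact (e.finrank_map_eq _).symm
  obtain ⟨h1, h2, h3, h4⟩ := finrank_span_sup_orthogonal B (Ω.bilinForm_nondegenerate x)
    (Ω.bilinForm_isRefl x) ρ (fun i => coalgDifferential (f i) (Φ x)) hrank
    (fun i j => (hΦ.form_infinitesimalAction x _ _).trans (hcomm i j))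
    (LinearIndependent.of_comp e.toLinearMap (by
      have : (e.toLinearMap ∘ fun i => B.compl₁₂ ρ ρ (coalgDifferential (f i) (Φ x))) =
        fun i => (Φ x).comp (adOp G (coalgDifferential (f i) (Φ x))) := funext fun i => hρ _
      rw [this]; exact hind))
  have hd : Module.finrank ℝ (TangentSpace (𝓡 d) x) = d := finrank_euclideanSpace_fin
  have hVL : V.map (Ω.sharp x).toLinearMap =
      Submodule.span ℝ (Set.range fun i => ρ (coalgDifferential (f i) (Φ x))) ⊔
        B.orthogonal (LinearMap.range ρ) := by
    have hinv' : Submodule.span ℝ ((fun u : C^∞⟮𝓡 d, M; ℝ⟯ => differential u x) ''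
        (invariantFunctions d G M)) = differentialSpan (invariantFunctions d G M) x := by
      rw [← differentialSpan_span, Submodule.span_eq]
    rw [hV, Set.image_union, Submodule.span_union, hinv', Submodule.map_sup,
      Ω.map_sharp_annihilator x _ hinv, Submodule.map_span]
    congr 2
    rw [← Set.range_comp, ← Set.range_comp]
    congr 1
    funext i
    exact hΦ.sgrad_comp_moment (f i) x
  have h5 := (Ω.sharp x).finrank_map_eq V
  have h6 := (Ω.sharp x).finrank_map_eq (cobracketKernel Ω x V)
  rw [Ω.map_sharp_cobracketKernel, hVL] at h6
  rw [hVL] at h5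
  rw [hd] at h2 h3
  rw [← h5, ← h6]
  exact ⟨h1, h2, h3, h4⟩

end Pointwise

theorem SymplecticForm.poissonMap_eq_zero_of_forGeneral {d : ℕ} {M : Type*} [TopologicalSpace M]
    [ChartedSpace (EuclideanSpace ℝ (Fin d)) M] [IsManifold (𝓡 d) ∞ M] (Ω : SymplecticForm d M)
    {f g : C^∞⟮𝓡 d, M; ℝ⟯} (h : ForGeneral fun x => Ω.poissonMap f g x = 0) :
    Ω.poissonMap f g = 0 := by
  obtain ⟨U, -, hU, h⟩ := h
  have := (Ω.poissonMap f g).contMDiff.continuous.ext_on hU continuous_const h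
  ext x
  exact congrFun this x

end GeneralPoints

end

/-! ### The complete algebras of integrals -/

theorem theorem2p2 {n k : ℕ}
    -- a connected symplectic manifold `M` of dimension `2n`
    {M : Type*} [TopologicalSpace M] [ChartedSpace (EuclideanSpace ℝ (Fin (2 * n))) M]
    [IsManifold (𝓡 (2 * n)) ∞ M] [T2Space M] [SecondCountableTopology M] [ConnectedSpace M]
    (Ω : SymplecticForm (2 * n) M)
    -- with a Hamiltonian action of a connected Lie group `G`
    {G : Type*} [TopologicalSpace G] [ChartedSpace (EuclideanSpace ℝ (Fin k)) G]
    [Group G] [LieGroup (𝓡 k) ∞ G] [ConnectedSpace G] [MulAction G M]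
    (Φ : C^∞⟮𝓡 (2 * n), M; 𝓘(ℝ, LieCoalg k), LieCoalg k⟯)
    (hΦ : IsHamiltonianAction G Ω Φ)
    (hinv : InvariantsSpanAnnihilators k (2 * n) G M)
    -- a Hamiltonian `h` and functions `f 0, …, f (l - 1)` on `𝔤*`
    (h : C^∞⟮𝓘(ℝ, LieCoalg k), LieCoalg k; ℝ⟯) {l : ℕ}
    (f : Fin l → C^∞⟮𝓘(ℝ, LieCoalg k), LieCoalg k; ℝ⟯)
    (hint : ForGeneral fun x : M =>
      IsIntegrableOnCoadjointOrbit G h (fun i => (f i : LieCoalg k → ℝ)) (Φ x)) :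
    -- the sum of the span of the `f i ∘ Φ` and of the invariant functions
    IsCompleteAlgebra Ω
      (Submodule.span ℝ (Set.range fun i => (f i).comp Φ) ⊔ invariantFunctions (2 * n) G M) ∧
    AreIntegrals Ω (h.comp Φ)
      (Submodule.span ℝ (Set.range fun i => (f i).comp Φ) ⊔ invariantFunctions (2 * n) G M) ∧
    -- the algebra of functions generated by the `f i ∘ Φ` and the invariant functions
    IsCompleteAlgebra Ω (Subalgebra.toSubmodule (Algebra.adjoin ℝ
      ((Set.range fun i => (f i).comp Φ) ∪ invariantFunctions (2 * n) G M))) ∧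
    AreIntegrals Ω (h.comp Φ) (Subalgebra.toSubmodule (Algebra.adjoin ℝ
      ((Set.range fun i => (f i).comp Φ) ∪ invariantFunctions (2 * n) G M))) ∧
    IsCompletelyIntegrable Ω (h.comp Φ) := by
  set s : Set C^∞⟮𝓡 (2 * n), M; ℝ⟯ :=
    (Set.range fun i => (f i).comp Φ) ∪ invariantFunctions (2 * n) G M with hs
  have hspan : Submodule.span ℝ (Set.range fun i => (f i).comp Φ) ⊔
      invariantFunctions (2 * n) G M = Submodule.span ℝ s := by
    rw [hs, Submodule.span_union, Submodule.span_eq]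
  rw [hspan]
  -- the brackets of the generators
  have hff : ∀ i j, Ω.poissonMap ((f i).comp Φ) ((f j).comp Φ) = 0 := fun i j =>
    Ω.poissonMap_eq_zero_of_forGeneral <| hint.mono fun x hx => by
      rw [hΦ.poissonMap_comp_moment, ← coadjointAction_one (G := G) (Φ x)]
      exact hx.commute 1 i j
  have hhf : ∀ i, Ω.poissonMap (h.comp Φ) ((f i).comp Φ) = 0 := fun i =>
    Ω.poissonMap_eq_zero_of_forGeneral <| hint.mono fun x hx => by
      rw [hΦ.poissonMap_comp_moment, ← coadjointAction_one (G := G) (Φ x)]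
      exact hx.integral 1 i
  have hfu : ∀ (F : C^∞⟮𝓘(ℝ, LieCoalg k), LieCoalg k; ℝ⟯),
      ∀ u ∈ invariantFunctions (2 * n) G M, Ω.poissonMap (F.comp Φ) u = 0 := fun F u hu => by
    rw [Ω.poissonMap_swap, hΦ.poissonMap_invariant_comp_moment hu, neg_zero]
  have hss : ∀ u ∈ s, ∀ v ∈ s, Ω.poissonMap u v ∈ Submodule.span ℝ s := by
    rintro u (⟨i, rfl⟩ | hu) v (⟨j, rfl⟩ | hv)
    · exact hff i j ▸ Submodule.zero_mem _
    · exact hfu (f i) v hv ▸ Submodule.zero_mem _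
    · exact hΦ.poissonMap_invariant_comp_moment hu (f j) ▸ Submodule.zero_mem _
    · exact Submodule.subset_span (Or.inr (hΦ.poissonMap_mem_invariantFunctions hu hv))
  have hhs : ∀ u ∈ s, Ω.poissonMap (h.comp Φ) u = 0 := by
    rintro u (⟨i, rfl⟩ | hu)
    · exact hhf i
    · exact hfu h u hu
  -- the dimensions at general points
  obtain ⟨m, hm⟩ := hinv
  have hind := hΦ.forGeneral_linearIndependent (fun i => (f i).contMDiff.contDiff)
    (hint.mono fun x hx => hx.independent)
  have hgen := ((hm.and hint).and hind).mono fun x hx =>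
    And.intro hx.1.1.1 fun V => hΦ.finrank_differentialSpan f (V := V) hx.1.1.2 hx.1.2.dim_orbit
      (fun i j => by
        rw [← coadjointAction_one (G := G) (Φ x)]
        exact hx.1.2.commute 1 i j) hx.2
  have hcomplete : ∀ F : Submodule ℝ C^∞⟮𝓡 (2 * n), M; ℝ⟯,
      (∀ x, differentialSpan F x =
        Submodule.span ℝ ((fun u : C^∞⟮𝓡 (2 * n), M; ℝ⟯ => differential u x) '' s)) →
      ∃ ddim dind : ℕ, ddim + dind = 2 * n ∧ ForGeneral fun x : M =>
        Module.finrank ℝ (differentialSpan F x) = ddim ∧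
        Module.finrank ℝ (cobracketKernel Ω x (differentialSpan F x)) = dind := by
    intro F hF
    refine ⟨2 * n - m + l, m - l, ?_, hgen.mono ?_⟩
    · obtain ⟨x, rfl, hx⟩ := hgen.exists
      obtain ⟨h1, h2, -⟩ := hx _ (hF x)
      omega
    · rintro x ⟨rfl, hx⟩
      exact (hx _ (hF x)).2.2
  have hsle : Submodule.span ℝ s ≤ Subalgebra.toSubmodule (Algebra.adjoin ℝ s) :=
    Algebra.span_le_adjoin ℝ s
  have hint' : AreIntegrals Ω (h.comp Φ) (Subalgebra.toSubmodule (Algebra.adjoin ℝ s)) :=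
    fun u hu x => DFunLike.congr_fun (Ω.poissonMap_eq_zero_of_mem_adjoin hhs hu) x
  have hcA : IsCompleteAlgebra Ω (Submodule.span ℝ s) :=
    ⟨fun u hu v hv => ⟨_, Ω.poissonMap_mem_span hss hu hv, fun _ => rfl⟩,
      hcomplete _ (differentialSpan_span s)⟩
  have hcS : IsCompleteAlgebra Ω (Subalgebra.toSubmodule (Algebra.adjoin ℝ s)) :=
    ⟨fun u hu v hv => ⟨_, Ω.poissonMap_mem_adjoin (fun u hu v hv => hsle (hss u hu v hv)) hu hv,
      fun _ => rfl⟩, hcomplete _ (differentialSpan_adjoin s)⟩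
  have hintA : AreIntegrals Ω (h.comp Φ) (Submodule.span ℝ s) := fun u hu => hint' u (hsle hu)
  exact ⟨hcA, hintA, hcS, hint', _, hcA, hintA⟩
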